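/- Let $p$ be a prime and let $G$ be a Tarski monster group of order $p$, i.e. an infinite, finitely generated group in which every nontrivial proper subgroup is cyclic of order $p$. Assume that $G$ is non-amenable, i.e. that there is no positive unital linear functional on $\ell^\infty(G)$ which is invariant under left translation. A $G$-boundary is a non-empty compact Hausdorff space $X$ on which the discrete group $G$ acts by homeomorphisms such that every orbit is dense (minimality) and, for every regular Borel probability measure $\nu$ on $X$, the weak* closure of the orbit $G\nu$ contains a point mass $\delta_x$, $x\in X$ (strong proximality). The Furstenberg boundary $\partial_F G$ is the universal $G$-boundary, i.e. the $G$-boundary (unique up to $G$-equivariant homeomorphism) of which every $G$-boundary is a continuous $G$-equivariant image. Then: 1. The Furstenberg boundary $\partial_F G$ exists, and the action of $G$ on it is topologically free: for every $s\in G\setminus\{e\}$ the set $\{x\in\partial_F G \mid sx\neq x\}$ is dense in $\partial_F G$. 2. $G$ is C*-simple: the reduced C*-algebra $\mathrm{C}^*_r(G)$, i.e. the norm closed *-subalgebra of $B(\ell^2(G))$ generated by the operators $\lambda_s$, $s\in G$, $(\lambda_s\xi)(t)=\xi(s^{-1}t)$, has no closed two-sided ideals other than $\{0\}$ and $\mathrm{C}^*_r(G)$.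 -/

import Mathlib

open scoped ENNReal ComplexOrder

universe u

namespace Tarski

/-! ### Compact `G`-spaces, boundaries and the Furstenberg boundary

A compact `G`-space for a discrete group `G` is a compact Hausdorff space with an action of `G`
by homeomorphisms, i.e. with `MulAction G X` and `ContinuousConstSMul G X`. -/

section Boundary

variable (G : Type u) [Group G]
variable (X : Type u) [TopologicalSpace X] [MulAction G X]

/-- The action is topologically free: every `s ≠ 1` moves a dense set of points. -/
def IsTopologicallyFree : Prop :=
  ∀ s : G, s ≠ 1 → Dense {x : X | s • x ≠ x}

/-- The action is strongly proximal: for every regular Borel probability measure `ν` on `X`, the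
weak-* closure of the orbit `G ν` contains a point mass. -/
def IsStronglyProximal [ContinuousConstSMul G X] : Prop :=
  letI : MeasurableSpace X := borel X
  haveI : BorelSpace X := ⟨rfl⟩
  ∀ ν : MeasureTheory.ProbabilityMeasure X, (ν : MeasureTheory.Measure X).Regular →
    ∃ x : X, MeasureTheory.diracProba x ∈
      closure (Set.range fun s : G =>
        ν.map (f := fun y : X => s • y) (continuous_const_smul s).measurable.aemeasurable)

/-- A `G`-boundary: a nonempty compact Hausdorff `G`-space on which the action is minimal (every
orbit is dense) and strongly proximal. -/
structure IsBoundary [ContinuousConstSMul G X] : Prop where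
  compact : CompactSpace X
  hausdorff : T2Space X
  nonempty : Nonempty X
  minimal : MulAction.IsMinimal G X
  stronglyProximal : IsStronglyProximal G X

/-- `X` is a Furstenberg boundary of `G`, i.e. a universal `G`-boundary: it is a `G`-boundary and
every `G`-boundary is a continuous `G`-equivariant image of it. It is enough to let `Y` range over
the universe of `G`: a `G`-boundary is a continuous image of the Stone-Čech compactification of the
discrete space `G`, hence is homeomorphic to a space in that universe. -/
structure IsFurstenbergBoundary [ContinuousConstSMul G X] : Prop where
  isBoundary : IsBoundary G X
  universal : ∀ (Y : Type u) [TopologicalSpace Y] [MulAction G Y] [ContinuousConstSMul G Y],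
    IsBoundary G Y → ∃ f : X → Y, Continuous f ∧ Function.Surjective f ∧
      ∀ (s : G) (x : X), f (s • x) = s • f x

end Boundary

/-! ### Amenability and Tarski monsters -/

section Groups

variable (G : Type u) [Group G]

/-- `G` is amenable: there is a positive unital linear functional `m` on `ℓ^∞(G)` that is invariant
under the left translations `(s f)(t) = f (s⁻¹ t)`. -/
def IsAmenable : Prop :=
  ∃ m : lp (fun _ : G => ℂ) ∞ →ₗ[ℂ] ℂ,
    m 1 = 1 ∧
    (∀ f : lp (fun _ : G => ℂ) ∞, (∀ t, 0 ≤ f t) → 0 ≤ m f) ∧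
    ∀ (s : G) (f g : lp (fun _ : G => ℂ) ∞), (∀ t, g t = f (s⁻¹ * t)) → m g = m f

/-- `G` is a Tarski monster of order `p`: `p` is prime and `G` is an infinite finitely generated
group all of whose nontrivial proper subgroups are cyclic of order `p`. -/
structure IsTarskiMonster (p : ℕ) : Prop where
  prime : p.Prime
  infinite : Infinite G
  fg : Group.FG G
  cyclic : ∀ H : Subgroup G, H ≠ ⊥ → H ≠ ⊤ → IsCyclic H ∧ Nat.card H = p

end Groups

/-! ### The reduced C*-algebra -/

section Reduced

variable (G : Type u) [Group G]

/-- The Hilbert space `ℓ²(G)`. -/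
abbrev ell2 : Type u := lp (fun _ : G => ℂ) 2

variable {G}

theorem memlp_translate (s : G) (ξ : ell2 G) :
    Memℓp (fun t : G => ξ (s⁻¹ * t)) 2 := by
  have h := (memℓp_gen_iff (p := 2) (by norm_num)).1 (lp.memℓp ξ)
  exact (memℓp_gen_iff (p := 2) (by norm_num)).2
    ((Equiv.mulLeft s⁻¹).summable_iff.2 h)

/-- The left regular representation as isometries: `(λ_s ξ)(t) = ξ (s⁻¹ t)`. -/
noncomputable def leftRegularIsometry (s : G) : ell2 G →ₗᵢ[ℂ] ell2 G where
  toFun ξ := ⟨fun t => ξ (s⁻¹ * t), memlp_translate s ξ⟩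
  map_add' _ _ := rfl
  map_smul' _ _ := rfl
  norm_map' ξ := by
    rw [lp.norm_eq_tsum_rpow (by norm_num), lp.norm_eq_tsum_rpow (by norm_num)]
    congr 1
    exact (Equiv.mulLeft s⁻¹).tsum_eq fun t => ‖ξ t‖ ^ (2 : ℝ≥0∞).toReal

/-- The unitary operators `λ_s` of the left regular representation, as elements of `B(ℓ²(G))`. -/
noncomputable def leftRegular (s : G) : ell2 G →L[ℂ] ell2 G :=
  (leftRegularIsometry s).toContinuousLinearMap

variable (G)

/-- The reduced C*-algebra of `G`: the C*-subalgebra of `B(ℓ²(G))` generated by the operators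
`λ_s`, i.e. the norm closure of the *-algebra that they generate. -/
noncomputable def reducedCStarAlgebra : StarSubalgebra ℂ (ell2 G →L[ℂ] ell2 G) :=
  (StarAlgebra.adjoin ℂ (Set.range (leftRegular (G := G)))).topologicalClosure

/-- `G` is C*-simple: the only closed two-sided ideals of its reduced C*-algebra are zero and the
whole algebra (which is unital and nonzero). -/
def IsCStarSimple : Prop :=
  ∀ I : TwoSidedIdeal (reducedCStarAlgebra G),
    IsClosed (I : Set (reducedCStarAlgebra G)) → I = ⊥ ∨ I = ⊤

end Reduced

end Tarski

namespace Tarski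

open scoped BoundedContinuousFunction Pointwise
open Set Filter Topology

/-! ### States on algebras of bounded continuous functions -/

section States

variable {Z Y : Type*} [TopologicalSpace Z] [TopologicalSpace Y]

/-! Boundary. Among the nonempty closed convex `G`-invariant sets of states on the bounded functions
on `G`, take a minimal one `K`; its closed extreme boundary `closure (K.extremePoints ℝ)` is the
Furstenberg boundary. Minimality and Milman's theorem put every extreme point of `K` into every
orbit closure in `K` (`mem_closure_orbit_of_mem_extremePoints`), which gives minimality of the
action. For strong proximality, push the barycenter of a state on this set towards an extreme point
`e`: a limit of the states then has barycenter `e`, and such a state is a point mass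
(`eq_pointState_of_barycenter_mem_extremePoints`). For universality, push `K` forward along an orbit
map into a boundary `Y`: some extreme point of `K` goes to a point evaluation, hence all of them do
(`exists_equivariant_map`).

Freeness. Points of this model are states, so by universality a global fixed point on a Furstenberg
boundary would give an invariant mean. If `s ≠ 1` fixes a nonempty open set pointwise, the
stabilizers there are proper and contain `s`, so all equal `zpowers s`. By compactness and
minimality finitely many translates of the open set cover, so `s` has finitely many conjugates. In a
Tarski monster its centralizer is then everything, which is impossible.

Simplicity. By Baire some `y` has trivial stabilizer. A proper ideal is killed by a unital
contractive functional on `B(ℓ²(G))`. Conjugating it by the `λ_s` and passing to a limit gives such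
a functional `φ` that restricts to evaluation at `y` on `C(X)`, still killing the ideal. For `s ≠ 1`
the points `y` and `s • y` are separated by a function, which forces `φ (λ_s) = 0`
(`apply_leftRegular_eq_zero`). So `φ` is the canonical trace on the reduced algebra; the trace is
faithful there, and the ideal is zero. -/

instance weakDual_locallyConvexSpace {A : Type*} [NormedAddCommGroup A] [NormedSpace ℝ A] :
    LocallyConvexSpace ℝ (WeakDual ℝ A) :=
  inferInstanceAs (LocallyConvexSpace ℝ (WeakBilin (topDualPairing ℝ A)))

/-- The dual of a normed space with the weak-* topology. -/
abbrev NormedWeakDual (A : Type*) [NormedAddCommGroup A] [NormedSpace ℝ A] : Type _ := WeakDual ℝ A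

/-- The continuous functionals on the bounded continuous functions, with the weak-* topology. -/
abbrev Functional (Z : Type*) [TopologicalSpace Z] : Type _ := NormedWeakDual (Z →ᵇ ℝ)

/-- Every weak-* continuous functional is an evaluation. -/
theorem exists_eval_eq {A : Type*} [NormedAddCommGroup A] [NormedSpace ℝ A]
    (l : WeakDual ℝ A →L[ℝ] ℝ) : ∃ a : A, ∀ φ : WeakDual ℝ A, l φ = φ a := by
  obtain ⟨a, ha⟩ := LinearMap.dualEmbedding_surjective (topDualPairing ℝ A) l
  exact ⟨a, fun φ => (DFunLike.congr_fun ha φ).symm⟩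

/-- The transpose of a continuous linear map, for the weak-* topologies. -/
noncomputable def transpose {A B : Type*} [NormedAddCommGroup A] [NormedSpace ℝ A]
    [NormedAddCommGroup B] [NormedSpace ℝ B] (T : A →L[ℝ] B) :
    WeakDual ℝ B →L[ℝ] WeakDual ℝ A where
  toFun φ := StrongDual.toWeakDual ((WeakDual.toStrongDual φ).comp T)
  map_add' _ _ := rfl
  map_smul' _ _ := rfl
  cont := WeakDual.continuous_of_continuous_eval fun a => WeakDual.eval_continuous (T a)

variable (Z) in
/-- The states on the bounded continuous functions: positive functionals of value one at one. -/
def stateSpace : Set (Functional Z) :=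
  {φ | φ 1 = 1 ∧ ∀ f : Z →ᵇ ℝ, (∀ z, 0 ≤ f z) → 0 ≤ φ f}

theorem stateSpace_mono {φ : Functional Z} (hφ : φ ∈ stateSpace Z) {f g : Z →ᵇ ℝ}
    (h : ∀ z, f z ≤ g z) : φ f ≤ φ g := by
  have := hφ.2 (g - f) fun z => by simpa using h z
  rw [map_sub] at this
  linarith

theorem stateSpace_const {φ : Functional Z} (hφ : φ ∈ stateSpace Z) (c : ℝ) :
    φ (c • 1) = c := by
  rw [map_smul, hφ.1, smul_eq_mul, mul_one]

theorem stateSpace_abs_le {φ : Functional Z} (hφ : φ ∈ stateSpace Z) {f g : Z →ᵇ ℝ}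
    (h : ∀ z, |f z| ≤ g z) : |φ f| ≤ φ g := by
  refine abs_le.2 ⟨?_, stateSpace_mono hφ fun z => (abs_le.1 (h z)).2⟩
  rw [← map_neg]
  exact stateSpace_mono hφ fun z => by simpa using (abs_le.1 (h z)).1

theorem stateSpace_abs_le_norm {φ : Functional Z} (hφ : φ ∈ stateSpace Z) (f : Z →ᵇ ℝ) :
    |φ f| ≤ ‖f‖ := by
  rw [← stateSpace_const hφ ‖f‖]
  exact stateSpace_abs_le hφ fun z => by simpa using f.norm_coe_le_norm z

theorem isClosed_stateSpace : IsClosed (stateSpace Z) := by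
  have h : stateSpace Z = {φ | φ 1 = 1} ∩
      ⋂ f : {f : Z →ᵇ ℝ // ∀ z, 0 ≤ f z}, {φ : Functional Z | 0 ≤ φ f.1} := by
    ext φ
    simp [stateSpace]
  rw [h]
  exact (isClosed_eq (WeakDual.eval_continuous 1) continuous_const).inter
    (isClosed_iInter fun f => isClosed_le continuous_const (WeakDual.eval_continuous f.1))

theorem isCompact_stateSpace : IsCompact (stateSpace Z) := by
  refine (WeakDual.isCompact_closedBall (0 : StrongDual ℝ (Z →ᵇ ℝ)) 1).of_isClosed_subset
    isClosed_stateSpace fun φ hφ => ?_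
  rw [mem_preimage, mem_closedBall_zero_iff]
  refine ContinuousLinearMap.opNorm_le_bound _ zero_le_one fun f => ?_
  rw [one_mul]
  exact stateSpace_abs_le_norm hφ f

theorem convex_stateSpace : Convex ℝ (stateSpace Z) := by
  intro φ hφ ψ hψ a b ha hb hab
  refine ⟨?_, fun f hf => ?_⟩
  · change a * φ 1 + b * ψ 1 = 1
    rw [hφ.1, hψ.1]; linarith
  · change 0 ≤ a * φ f + b * ψ f
    have := hφ.2 f hf
    have := hψ.2 f hf
    positivity

/-- Composition with a continuous map, as a continuous linear map. -/
noncomputable def pullback (h : C(Z, Y)) : (Y →ᵇ ℝ) →L[ℝ] (Z →ᵇ ℝ) :=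
  LinearMap.mkContinuous
    { toFun := fun f => f.compContinuous h
      map_add' := fun _ _ => rfl
      map_smul' := fun _ _ => rfl } 1 fun f => by
    rw [one_mul]
    exact (BoundedContinuousFunction.norm_le (norm_nonneg f)).2 fun z => f.norm_coe_le_norm (h z)

/-- The push-forward of functionals along a continuous map. -/
noncomputable def push (h : C(Z, Y)) : Functional Z →L[ℝ] Functional Y :=
  transpose (pullback h)

theorem push_mem (h : C(Z, Y)) {φ : Functional Z} (hφ : φ ∈ stateSpace Z) :
    push h φ ∈ stateSpace Y :=
  ⟨hφ.1, fun f hf => hφ.2 (pullback h f) fun z => hf (h z)⟩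

/-- The point evaluation at `z`. -/
noncomputable def pointState (z : Z) : Functional Z :=
  StrongDual.toWeakDual (BoundedContinuousFunction.evalCLM ℝ z)

@[simp]
theorem pointState_apply (z : Z) (f : Z →ᵇ ℝ) : pointState z f = f z := rfl

theorem pointState_mem (z : Z) : pointState z ∈ stateSpace Z :=
  ⟨rfl, fun _ hf => hf z⟩

theorem continuous_pointState : Continuous (pointState : Z → Functional Z) :=
  WeakDual.continuous_of_continuous_eval fun f => f.continuous

theorem pointState_injective [CompactSpace Z] [T2Space Z] :
    Function.Injective (pointState : Z → Functional Z) := by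
  intro x y hxy
  by_contra hne
  obtain ⟨f, hf0, hf1, -⟩ := exists_continuous_zero_one_of_isClosed (isClosed_singleton (x := x))
    (isClosed_singleton (x := y)) (by simpa using hne)
  have h := DFunLike.congr_fun hxy (BoundedContinuousFunction.mkOfCompact f)
  simp only [pointState_apply, BoundedContinuousFunction.mkOfCompact_apply] at h
  rw [hf0 rfl, hf1 rfl] at h
  simp at h

/-- A state that kills every nonnegative function vanishing at `z` is the evaluation at `z`. -/
theorem eq_pointState {φ : Functional Z} (hφ : φ ∈ stateSpace Z) (z : Z)
    (h : ∀ f : Z →ᵇ ℝ, (∀ w, 0 ≤ f w) → f z = 0 → φ f ≤ 0) : φ = pointState z := by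
  refine DFunLike.ext _ _ fun f => ?_
  let g : Z →ᵇ ℝ := f - f z • 1
  have hg : ∀ w, g w = f w - f z := fun w => by simp [g]
  have h0 := h |g| (fun w => by simp) (by simp [hg])
  have h1 : |φ g| ≤ φ |g| := stateSpace_abs_le hφ fun w => by simp
  have h2 : φ g = 0 := abs_eq_zero.1 (le_antisymm (h1.trans h0) (abs_nonneg _))
  rw [map_sub, stateSpace_const hφ] at h2
  rw [pointState_apply]
  linarith

/-- Each component of a convex decomposition is dominated by a multiple of the evaluation, so it
kills the nonnegative functions vanishing at `z`, and `eq_pointState` applies. -/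
theorem pointState_mem_extremePoints (z : Z) : pointState z ∈ (stateSpace Z).extremePoints ℝ := by
  rw [mem_extremePoints]
  refine ⟨pointState_mem z, fun φ hφ ψ hψ ⟨a, b, ha, hb, hab, h⟩ => ?_⟩
  have key : ∀ f : Z →ᵇ ℝ, a * φ f + b * ψ f = f z := fun f => DFunLike.congr_fun h f
  constructor
  · refine eq_pointState hφ z fun f hf hz => ?_
    have h1 := key f
    have h2 := mul_nonneg hb.le (hψ.2 f hf)
    by_contra! hc
    have := mul_pos ha hc
    linarith
  · refine eq_pointState hψ z fun f hf hz => ?_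
    have h1 := key f
    have h2 := mul_nonneg ha.le (hφ.2 f hf)
    by_contra! hc
    have := mul_pos hb hc
    linarith

end States

/-! ### Barycenters -/

section Barycenter

variable {Z : Type*} [TopologicalSpace Z] {B K : Set (Functional Z)}
  {e : Functional Z}

/-- A function on `Z`, viewed as a function on a set of states. -/
noncomputable def evalOn (hB : B ⊆ stateSpace Z) : (Z →ᵇ ℝ) →L[ℝ] (B →ᵇ ℝ) :=
  LinearMap.mkContinuous
    { toFun := fun a => BoundedContinuousFunction.ofNormedAddCommGroup (fun x : B => x.1 a)
        ((WeakDual.eval_continuous a).comp continuous_subtype_val) ‖a‖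
        fun x => stateSpace_abs_le_norm (hB x.2) a
      map_add' := fun a b => by ext x; exact map_add x.1 a b
      map_smul' := fun c a => by ext x; exact map_smul x.1 c a } 1 fun a => by
    rw [one_mul]
    exact (BoundedContinuousFunction.norm_le (norm_nonneg a)).2 fun x =>
      stateSpace_abs_le_norm (hB x.2) a

@[simp]
theorem evalOn_apply (hB : B ⊆ stateSpace Z) (a : Z →ᵇ ℝ) (x : B) : evalOn hB a x = x.1 a := rfl

/-- The barycenter of a state on a set of states. -/
noncomputable def barycenter (hB : B ⊆ stateSpace Z) :
    Functional B →L[ℝ] Functional Z :=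
  transpose (evalOn hB)

theorem barycenter_apply (hB : B ⊆ stateSpace Z) (μ : Functional B) (a : Z →ᵇ ℝ) :
    barycenter hB μ a = μ (evalOn hB a) := rfl

theorem barycenter_pointState (hB : B ⊆ stateSpace Z) (x : B) :
    barycenter hB (pointState x) = x.1 := rfl

/-- Hahn–Banach: a separating weak-* continuous functional is evaluation at some `a`, and its bound
on `B` survives averaging by the state `μ`. -/
theorem barycenter_mem (hB : B ⊆ stateSpace Z) (hBK : B ⊆ K) (hKc : IsClosed K)
    (hKconv : Convex ℝ K) {μ : Functional B} (hμ : μ ∈ stateSpace B) :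
    barycenter hB μ ∈ K := by
  by_contra hn
  obtain ⟨l, r, hl, hr⟩ := geometric_hahn_banach_closed_point hKconv hKc hn
  obtain ⟨a, ha⟩ := exists_eval_eq l
  rw [ha, barycenter_apply, ← not_le] at hr
  apply hr
  rw [← stateSpace_const hμ r]
  refine stateSpace_mono hμ fun x => ?_
  have := hl x.1 (hBK x.2)
  rw [ha] at this
  simpa using this.le

/-- The weights `h` and `1 - h`, after normalization, split `μ` into two states whose barycenters
lie in `K` and average to `e`; extremality makes both equal to `e`. The margin `δ` keeps both masses
positive. -/
theorem barycenter_apply_mul_of_mem_extremePoints (hB : B ⊆ stateSpace Z) (hBK : B ⊆ K)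
    (hKc : IsClosed K) (hKconv : Convex ℝ K) (he : e ∈ K.extremePoints ℝ)
    {μ : Functional B} (hμ : μ ∈ stateSpace B) (hμe : barycenter hB μ = e)
    {h : B →ᵇ ℝ} {δ : ℝ} (hδ : 0 < δ) (h0 : ∀ x, δ ≤ h x) (h1 : ∀ x, h x ≤ 1 - δ)
    (a : Z →ᵇ ℝ) : μ (h * evalOn hB a) = μ h * e a := by
  have aux : ∀ k : B →ᵇ ℝ, (∀ x, δ ≤ k x) → 0 < μ k ∧
      (μ k)⁻¹ • transpose (ContinuousLinearMap.mul ℝ (B →ᵇ ℝ) k) μ ∈ stateSpace B := by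
    intro k hk
    have hpos : 0 < μ k := by
      have := stateSpace_mono hμ (f := δ • 1) (g := k) fun x => by simpa using hk x
      rw [stateSpace_const hμ] at this
      exact hδ.trans_le this
    refine ⟨hpos, ?_, fun f hf => ?_⟩
    · change (μ k)⁻¹ * μ (k * 1) = 1
      rw [mul_one, inv_mul_cancel₀ hpos.ne']
    · change 0 ≤ (μ k)⁻¹ * μ (k * f)
      exact mul_nonneg (inv_nonneg.2 hpos.le)
        (hμ.2 _ fun x => mul_nonneg (hδ.le.trans (hk x)) (hf x))
  obtain ⟨hc, hs⟩ := aux h h0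
  obtain ⟨hc', hs'⟩ := aux (1 - h) fun x => by
    have := h1 x
    simp only [BoundedContinuousFunction.coe_sub, Pi.sub_apply, BoundedContinuousFunction.coe_one,
      Pi.one_apply]
    linarith
  have hsum : μ h + μ (1 - h) = 1 := by rw [← map_add, add_sub_cancel, hμ.1]
  have hseg := (mem_extremePoints.1 he).2 _ (barycenter_mem hB hBK hKc hKconv hs)
    _ (barycenter_mem hB hBK hKc hKconv hs') ⟨μ h, μ (1 - h), hc, hc', hsum, ?_⟩
  · have := DFunLike.congr_fun hseg.1 a
    change (μ h)⁻¹ * μ (h * evalOn hB a) = e a at this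
    rw [← this, mul_inv_cancel_left₀ hc.ne']
  · rw [← hμe]
    refine DFunLike.ext _ _ fun b => ?_
    change μ h * ((μ h)⁻¹ * μ (h * evalOn hB b)) +
      μ (1 - h) * ((μ (1 - h))⁻¹ * μ ((1 - h) * evalOn hB b)) = μ (evalOn hB b)
    rw [mul_inv_cancel_left₀ hc.ne', mul_inv_cancel_left₀ hc'.ne', ← map_add]
    congr 1
    ring

/-- Zero variance: the preceding lemma with the weight `1/2 + t • evalOn hB a` shows that `a` is
uncorrelated with itself. The scale `t` keeps the weight in `[1/4, 3/4]`. -/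
theorem apply_sq_sub_of_mem_extremePoints (hB : B ⊆ stateSpace Z) (hBK : B ⊆ K)
    (hKc : IsClosed K) (hKconv : Convex ℝ K) (he : e ∈ K.extremePoints ℝ)
    {μ : Functional B} (hμ : μ ∈ stateSpace B) (hμe : barycenter hB μ = e)
    (a : Z →ᵇ ℝ) :
    μ ((evalOn hB a - e a • 1) * (evalOn hB a - e a • 1)) = 0 := by
  have hN : 0 < 4 * (‖a‖ + 1) := by positivity
  obtain ⟨t, ht, htN⟩ : ∃ t : ℝ, 0 < t ∧ t * ‖a‖ ≤ 1 / 4 := by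
    refine ⟨(4 * (‖a‖ + 1))⁻¹, inv_pos.2 hN, ?_⟩
    rw [inv_mul_le_iff₀ hN]
    linarith
  have hb : ∀ x : B, |t * x.1 a| ≤ 1 / 4 := fun x => by
    rw [abs_mul, abs_of_pos ht]
    exact (mul_le_mul_of_nonneg_left (stateSpace_abs_le_norm (hB x.2) a) ht.le).trans htN
  have hmean : μ (evalOn hB a) = e a := by rw [← hμe, barycenter_apply]
  have key := barycenter_apply_mul_of_mem_extremePoints hB hBK hKc hKconv he hμ hμe
    (h := (1 / 2 : ℝ) • 1 + t • evalOn hB a) (δ := 1 / 4) (by norm_num)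
    (fun x => by have := (abs_le.1 (hb x)).1; simp; linarith)
    (fun x => by have := (abs_le.1 (hb x)).2; simp; linarith) a
  rw [add_mul, smul_mul_assoc, smul_mul_assoc, one_mul, map_add, map_add, stateSpace_const hμ,
    map_smul, map_smul, map_smul, hmean, smul_eq_mul, smul_eq_mul, smul_eq_mul] at key
  have hsq : μ (evalOn hB a * evalOn hB a) = e a * e a := by
    have : t * (μ (evalOn hB a * evalOn hB a) - e a * e a) = 0 := by linarith
    rcases mul_eq_zero.1 this with h | h
    · exact absurd h ht.ne'
    · linarith
  have hexp : (evalOn hB a - e a • 1) * (evalOn hB a - e a • 1) =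
      evalOn hB a * evalOn hB a - (2 * e a) • evalOn hB a + (e a * e a) • 1 := by
    ext x
    simp
    ring
  rw [hexp, map_add, map_sub, stateSpace_const hμ, map_smul, hmean, hsq, smul_eq_mul]
  ring

/-- The compact set `{ε ≤ f}` misses `e`, so a finite sum `S` of the squares of zero `μ`-mean is
bounded below there. Then `f` is at most `ε` plus a multiple of `S`. -/
theorem apply_nonpos_of_barycenter_mem_extremePoints [CompactSpace B] (hB : B ⊆ stateSpace Z)
    (hBK : B ⊆ K) (hKc : IsClosed K) (hKconv : Convex ℝ K) (he : e ∈ K.extremePoints ℝ)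
    {μ : Functional B} (hμ : μ ∈ stateSpace B) (hμe : barycenter hB μ = e)
    {f : B →ᵇ ℝ} (hfe : ∀ x : B, x.1 = e → f x = 0) : μ f ≤ 0 := by
  refine le_of_forall_pos_le_add fun ε hε => ?_
  rw [zero_add]
  let g : (Z →ᵇ ℝ) → (B →ᵇ ℝ) := fun a => (evalOn hB a - e a • 1) * (evalOn hB a - e a • 1)
  have hg : ∀ a x, g a x = (x.1 a - e a) * (x.1 a - e a) := fun a x => by simp [g]
  have hg0 : ∀ a x, 0 ≤ g a x := fun a x => by rw [hg]; exact mul_self_nonneg _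
  have hC : IsCompact {x | ε ≤ f x} := (isClosed_le continuous_const f.continuous).isCompact
  obtain ⟨t, ht⟩ := hC.elim_finite_subcover (fun a => {x | 0 < g a x})
    (fun a => isOpen_lt continuous_const (g a).continuous) fun x hx => by
      have hne : x.1 ≠ e := fun h => by
        have := hfe x h
        rw [mem_ofPred_eq, this] at hx
        linarith
      obtain ⟨a, ha⟩ := DFunLike.ne_iff.1 hne
      refine mem_iUnion.2 ⟨a, ?_⟩
      rw [mem_ofPred_eq, hg]
      exact mul_self_pos.2 (sub_ne_zero.2 ha)
  let S : B →ᵇ ℝ := ∑ a ∈ t, g a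
  have hSx : ∀ x, S x = ∑ a ∈ t, g a x := fun x => by simp [S]
  have hS0 : ∀ x, 0 ≤ S x := fun x => by
    rw [hSx]; exact Finset.sum_nonneg fun a _ => hg0 a x
  have hSpos : ∀ x, ε ≤ f x → 0 < S x := fun x hx => by
    obtain ⟨a, hat, hax⟩ := mem_iUnion₂.1 (ht hx)
    rw [hSx]
    exact Finset.sum_pos' (fun a _ => hg0 a x) ⟨a, hat, hax⟩
  have hμS : μ S = 0 := by
    rw [map_sum]
    exact Finset.sum_eq_zero fun a _ =>
      apply_sq_sub_of_mem_extremePoints hB hBK hKc hKconv he hμ hμe a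
  obtain ⟨δ, hδ, hδS⟩ : ∃ δ > 0, ∀ x, ε ≤ f x → δ ≤ S x := by
    rcases eq_empty_or_nonempty {x | ε ≤ f x} with h | h
    · exact ⟨1, one_pos, fun x hx => absurd (show x ∈ {x | ε ≤ f x} from hx) (by simp [h])⟩
    · obtain ⟨x₀, hx₀, hmin⟩ := hC.exists_isMinOn h S.continuous.continuousOn
      exact ⟨S x₀, hSpos x₀ hx₀, fun x hx => hmin hx⟩
  have hle : μ f ≤ μ (ε • 1 + (‖f‖ / δ) • S) := by
    refine stateSpace_mono hμ fun x => ?_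
    simp only [BoundedContinuousFunction.coe_add, Pi.add_apply, BoundedContinuousFunction.coe_smul,
      BoundedContinuousFunction.coe_one, Pi.one_apply, smul_eq_mul, mul_one]
    rcases le_or_gt ε (f x) with h | h
    · have h1 : f x ≤ ‖f‖ := (le_abs_self _).trans (f.norm_coe_le_norm x)
      have h2 : ‖f‖ ≤ ‖f‖ / δ * S x := by
        rw [div_mul_eq_mul_div, le_div_iff₀ hδ]
        exact mul_le_mul_of_nonneg_left (hδS x h) (norm_nonneg f)
      linarith
    · have := mul_nonneg (div_nonneg (norm_nonneg f) hδ.le) (hS0 x)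
      linarith
  rw [map_add, stateSpace_const hμ, map_smul, hμS, smul_zero, add_zero] at hle
  exact hle

/-- A state whose barycenter is an extreme point is a point mass. -/
theorem eq_pointState_of_barycenter_mem_extremePoints [CompactSpace B] (hB : B ⊆ stateSpace Z)
    (hBK : B ⊆ K) (hKc : IsClosed K) (hKconv : Convex ℝ K) (he : e ∈ K.extremePoints ℝ)
    {μ : Functional B} (hμ : μ ∈ stateSpace B) (hμe : barycenter hB μ = e) :
    ∃ h : e ∈ B, μ = pointState ⟨e, h⟩ := by
  have heB : e ∈ B := by
    by_contra hn
    -- If `e ∉ B`, the vanishing condition is vacuous even for the constant one.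
    have := apply_nonpos_of_barycenter_mem_extremePoints hB hBK hKc hKconv he hμ hμe (f := 1)
      fun x hx => absurd (hx ▸ x.2) hn
    rw [hμ.1] at this
    linarith
  refine ⟨heB, eq_pointState hμ _ fun f _ hfe =>
    apply_nonpos_of_barycenter_mem_extremePoints hB hBK hKc hKconv he hμ hμe fun x hx => ?_⟩
  rwa [show x = ⟨e, heB⟩ from Subtype.ext hx]

/-- **Milman's theorem**: an extreme point in the closed convex hull of a compact set of states
lies in that set. -/
theorem mem_of_mem_extremePoints_of_mem_closure_convexHull (hB : B ⊆ stateSpace Z)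
    (hBc : IsCompact B) (hBK : B ⊆ K) (hKc : IsClosed K) (hKconv : Convex ℝ K)
    (he : e ∈ K.extremePoints ℝ) (heB : e ∈ closure (convexHull ℝ B)) : e ∈ B := by
  have : CompactSpace B := isCompact_iff_compactSpace.1 hBc
  -- The set of barycenters is convex, compact and contains `B`, so each point of the closed convex
  -- hull is represented by a state on `B`.
  have hsub : closure (convexHull ℝ B) ⊆ barycenter hB '' stateSpace B := by
    refine closure_minimal (convexHull_min (fun x hx => ⟨pointState ⟨x, hx⟩, pointState_mem _,
      barycenter_pointState hB _⟩) ?_) ?_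
    · exact convex_stateSpace.linear_image (barycenter hB).toLinearMap
    · exact (isCompact_stateSpace.image (barycenter hB).continuous).isClosed
  obtain ⟨μ, hμ, hμe⟩ := hsub heB
  exact (eq_pointState_of_barycenter_mem_extremePoints hB hBK hKc hKconv he hμ hμe).1

end Barycenter

/-! ### Group actions on state spaces and minimal convex sets -/

section Action

variable (G : Type*) [Group G] {Z Y : Type*}
  [TopologicalSpace Z] [MulAction G Z] [ContinuousConstSMul G Z]
  [TopologicalSpace Y] [MulAction G Y] [ContinuousConstSMul G Y]

variable {G} in
/-- The action of a group element on functionals. -/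
noncomputable def act (s : G) : Functional Z →L[ℝ] Functional Z :=
  push ⟨fun z => s • z, continuous_const_smul s⟩

variable {G} in
theorem act_mul (s t : G) (φ : Functional Z) : act (s * t) φ = act s (act t φ) := by
  refine DFunLike.ext _ _ fun f => congrArg φ ?_
  ext z
  exact congrArg f (mul_smul s t z)

theorem act_one (φ : Functional Z) : act (1 : G) φ = φ := by
  refine DFunLike.ext _ _ fun f => congrArg φ ?_
  ext z
  exact congrArg f (one_smul G z)

variable {G} in
theorem act_inv_act (s : G) (φ : Functional Z) : act s⁻¹ (act s φ) = φ := by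
  rw [← act_mul, inv_mul_cancel, act_one]

variable {G} in
theorem act_act_inv (s : G) (φ : Functional Z) : act s (act s⁻¹ φ) = φ := by
  rw [← act_mul, mul_inv_cancel, act_one]

variable {G} in
theorem act_mem (s : G) {φ : Functional Z} (hφ : φ ∈ stateSpace Z) :
    act s φ ∈ stateSpace Z :=
  push_mem _ hφ

variable {G} in
theorem act_pointState (s : G) (z : Z) : act s (pointState z) = pointState (s • z) := rfl

variable {G} in
theorem push_act (h : C(Z, Y)) (hh : ∀ (s : G) z, h (s • z) = s • h z) (s : G)
    (φ : Functional Z) : push h (act s φ) = act s (push h φ) := by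
  refine DFunLike.ext _ _ fun f => congrArg φ ?_
  ext z
  exact congrArg f (hh s z)

variable (Z) in
/-- The nonempty closed convex invariant sets of states. -/
def invariantConvexSets : Set (Set (Functional Z)) :=
  {K | K ⊆ stateSpace Z ∧ IsClosed K ∧ Convex ℝ K ∧ K.Nonempty ∧ ∀ (s : G), ∀ φ ∈ K, act s φ ∈ K}

theorem exists_minimal_invariantConvexSets [Nonempty Z] :
    ∃ K, Minimal (· ∈ invariantConvexSets G Z) K := by
  refine zorn_superset _ fun c hc hchain => ?_
  rcases c.eq_empty_or_nonempty with rfl | hne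
  · exact ⟨stateSpace Z, ⟨Subset.rfl, isClosed_stateSpace, convex_stateSpace,
      ⟨_, pointState_mem (Classical.arbitrary Z)⟩, fun s φ => act_mem s⟩, by simp⟩
  obtain ⟨K₀, hK₀⟩ := hne
  refine ⟨⋂₀ c, ⟨(sInter_subset_of_mem hK₀).trans (hc hK₀).1,
    isClosed_sInter fun K hK => (hc hK).2.1, convex_sInter fun K hK => (hc hK).2.2.1, ?_,
    fun s φ hφ K hK => (hc hK).2.2.2.2 s φ (hφ K hK)⟩,
    fun K hK => sInter_subset_of_mem hK⟩
  have : Nonempty c := ⟨⟨K₀, hK₀⟩⟩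
  exact IsCompact.nonempty_sInter_of_directed_nonempty_isCompact_isClosed
    (fun K hK L hL => (hchain.total hK hL).elim (fun h => ⟨K, hK, Subset.rfl, h⟩)
      fun h => ⟨L, hL, h, Subset.rfl⟩) (fun K hK => (hc hK).2.2.2.1)
    (fun K hK => isCompact_stateSpace.of_isClosed_subset (hc hK).2.1 (hc hK).1)
    fun K hK => (hc hK).2.1

variable {G} {K : Set (Functional Z)}

theorem act_mem_closure_range (k : Functional Z) (s : G) {φ : Functional Z}
    (hφ : φ ∈ closure (range fun t : G => act t k)) :
    act s φ ∈ closure (range fun t : G => act t k) := by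
  refine map_mem_closure (act s).continuous hφ ?_
  rintro _ ⟨t, rfl⟩
  exact ⟨s * t, act_mul s t k⟩

theorem closure_range_act_subset (hK : K ∈ invariantConvexSets G Z) {k : Functional Z}
    (hk : k ∈ K) : closure (range fun t : G => act t k) ⊆ K :=
  closure_minimal (range_subset_iff.2 fun s => hK.2.2.2.2 s k hk) hK.2.1

/-- The closed convex hull of an orbit closure is itself invariant, so by minimality it is all of
`K`. The inner closure supplies the compact set that Milman's theorem needs. -/
theorem mem_closure_convexHull_orbit (hK : Minimal (· ∈ invariantConvexSets G Z) K)
    {k e : Functional Z} (hk : k ∈ K) (he : e ∈ K) :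
    e ∈ closure (convexHull ℝ (closure (range fun t : G => act t k))) := by
  set B := closure (range fun t : G => act t k)
  have hBK : B ⊆ K := closure_range_act_subset hK.prop hk
  have hS : closure (convexHull ℝ B) ∈ invariantConvexSets G Z := by
    refine ⟨closure_minimal (convexHull_min (hBK.trans hK.prop.1) convex_stateSpace)
      isClosed_stateSpace, isClosed_closure, (convex_convexHull ℝ _).closure,
      ⟨k, subset_closure (subset_convexHull ℝ _ (subset_closure ⟨1, act_one G k⟩))⟩,
      fun s φ hφ => map_mem_closure (act s).continuous hφ fun ψ hψ => ?_⟩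
    have h : (act s).toLinearMap ψ ∈ (act s).toLinearMap '' convexHull ℝ B := ⟨ψ, hψ, rfl⟩
    rw [LinearMap.image_convexHull] at h
    refine convexHull_mono ?_ h
    rintro _ ⟨χ, hχ, rfl⟩
    exact act_mem_closure_range k s hχ
  have hSK : closure (convexHull ℝ B) ⊆ K :=
    closure_minimal (convexHull_min hBK hK.prop.2.2.1) hK.prop.2.1
  exact hK.2 hS hSK he

/-- In a minimal invariant convex set, every orbit closure contains every extreme point. -/
theorem mem_closure_orbit_of_mem_extremePoints (hK : Minimal (· ∈ invariantConvexSets G Z) K)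
    {k e : Functional Z} (hk : k ∈ K) (he : e ∈ K.extremePoints ℝ) :
    e ∈ closure (range fun t : G => act t k) := by
  have hsub := closure_range_act_subset hK.prop hk
  exact mem_of_mem_extremePoints_of_mem_closure_convexHull (hsub.trans hK.prop.1)
    (isCompact_stateSpace.of_isClosed_subset isClosed_closure (hsub.trans hK.prop.1)) hsub
    hK.prop.2.1 hK.prop.2.2.1 he (mem_closure_convexHull_orbit hK hk (extremePoints_subset he))

theorem act_mem_extremePoints (hK : K ∈ invariantConvexSets G Z) (s : G)
    {e : Functional Z} (he : e ∈ K.extremePoints ℝ) : act s e ∈ K.extremePoints ℝ := by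
  rw [mem_extremePoints] at he ⊢
  refine ⟨hK.2.2.2.2 s e he.1, fun φ hφ ψ hψ ⟨a, b, ha, hb, hab, h⟩ => ?_⟩
  have := he.2 _ (hK.2.2.2.2 s⁻¹ φ hφ) _ (hK.2.2.2.2 s⁻¹ ψ hψ) ⟨a, b, ha, hb, hab, by
    rw [← map_smul, ← map_smul, ← map_add, h, act_inv_act]⟩
  exact ⟨by rw [← this.1, act_act_inv], by rw [← this.2, act_act_inv]⟩

theorem act_mem_closure_extremePoints (hK : K ∈ invariantConvexSets G Z) (s : G)
    {e : Functional Z} (he : e ∈ closure (K.extremePoints ℝ)) :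
    act s e ∈ closure (K.extremePoints ℝ) :=
  map_mem_closure (act s).continuous he fun _ => act_mem_extremePoints hK s

theorem closure_extremePoints_subset (hK : K ∈ invariantConvexSets G Z) :
    closure (K.extremePoints ℝ) ⊆ K :=
  closure_minimal extremePoints_subset hK.2.1

/-- The action of the group on an invariant set of states. -/
@[reducible]
noncomputable def subAction (B : Set (Functional Z))
    (hB : ∀ (s : G), ∀ φ ∈ B, act s φ ∈ B) : MulAction G B where
  smul s x := ⟨act s x.1, hB s x.1 x.2⟩
  one_smul x := Subtype.ext (act_one G x.1)
  mul_smul s t x := Subtype.ext (act_mul s t x.1)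

theorem subAction_continuousConstSMul (B : Set (Functional Z))
    (hB : ∀ (s : G), ∀ φ ∈ B, act s φ ∈ B) :
    letI := subAction B hB
    ContinuousConstSMul G B :=
  letI := subAction B hB
  ⟨fun s => ((act s).continuous.comp continuous_subtype_val).subtype_mk _⟩

variable (G) in
/-- Strong proximality in terms of states: the weak-* closure of every orbit in the state space
contains a point evaluation. -/
def IsStateProximal (Z : Type*) [TopologicalSpace Z] [MulAction G Z] [ContinuousConstSMul G Z] :
    Prop :=
  ∀ ν ∈ stateSpace Z, ∃ z : Z, pointState z ∈ closure (range fun s : G => act s ν)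

/-- The orbit of the barycenter accumulates at an extreme point `e`. By compactness this limit lifts
to a limit of the states, whose barycenter is `e`; it must be the point mass at `e`. -/
theorem isStateProximal_closure_extremePoints
    (hK : Minimal (· ∈ invariantConvexSets G Z) K) :
    letI := subAction (closure (K.extremePoints ℝ))
      fun s _ => act_mem_closure_extremePoints hK.prop s
    haveI := subAction_continuousConstSMul (closure (K.extremePoints ℝ))
      fun s _ => act_mem_closure_extremePoints hK.prop s
    IsStateProximal G (closure (K.extremePoints ℝ)) := by
  let := subAction (closure (K.extremePoints ℝ))
      fun s _ => act_mem_closure_extremePoints hK.prop s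
  have := subAction_continuousConstSMul (closure (K.extremePoints ℝ))
      fun s _ => act_mem_closure_extremePoints hK.prop s
  intro ν hν
  have hsub := closure_extremePoints_subset hK.prop
  have hB : closure (K.extremePoints ℝ) ⊆ stateSpace Z := hsub.trans hK.prop.1
  have : CompactSpace (closure (K.extremePoints ℝ)) := isCompact_iff_compactSpace.1
    (isCompact_stateSpace.of_isClosed_subset isClosed_closure hB)
  obtain ⟨e, he⟩ := (isCompact_stateSpace.of_isClosed_subset hK.prop.2.1
    hK.prop.1).extremePoints_nonempty hK.prop.2.2.2.1
  have hb := barycenter_mem hB hsub hK.prop.2.1 hK.prop.2.2.1 hν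
  have hmem := mem_closure_orbit_of_mem_extremePoints hK hb he
  have hcl : closure (range fun s : G => act s ν) ⊆ stateSpace _ :=
    closure_minimal (range_subset_iff.2 fun s => act_mem s hν) isClosed_stateSpace
  have himg : closure (range fun t : G => act t (barycenter hB ν)) ⊆
      barycenter hB '' closure (range fun s : G => act s ν) := by
    refine closure_minimal (range_subset_iff.2 fun s => ⟨act s ν, subset_closure ⟨s, rfl⟩, rfl⟩) ?_
    exact ((isCompact_stateSpace.of_isClosed_subset isClosed_closure hcl).image
      (barycenter hB).continuous).isClosed
  obtain ⟨μ, hμ, hμe⟩ := himg hmem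
  obtain ⟨h, rfl⟩ := eq_pointState_of_barycenter_mem_extremePoints hB hsub hK.prop.2.1
    hK.prop.2.2.1 he (hcl hμ) hμe
  exact ⟨_, hμ⟩

theorem isMinimal_closure_extremePoints (hK : Minimal (· ∈ invariantConvexSets G Z) K) :
    letI := subAction (closure (K.extremePoints ℝ))
      fun s _ => act_mem_closure_extremePoints hK.prop s
    MulAction.IsMinimal G (closure (K.extremePoints ℝ)) := by
  let := subAction (closure (K.extremePoints ℝ))
      fun s _ => act_mem_closure_extremePoints hK.prop s
  refine ⟨fun x y => ?_⟩
  have h : closure (K.extremePoints ℝ) ⊆ closure (range fun t : G => act t x.1) :=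
    closure_minimal (fun e he => mem_closure_orbit_of_mem_extremePoints hK
      (closure_extremePoints_subset hK.prop x.2) he) isClosed_closure
  rw [closure_subtype]
  convert h y.2
  ext φ
  constructor
  · rintro ⟨_, ⟨s, rfl⟩, rfl⟩
    exact ⟨s, rfl⟩
  · rintro ⟨s, rfl⟩
    exact ⟨_, ⟨s, rfl⟩, rfl⟩

/-- An equivariant map to a state-proximal minimal space induces an equivariant map from the
closure of the extreme points of a minimal invariant convex set. -/
theorem exists_equivariant_map [CompactSpace Y] [T2Space Y] [MulAction.IsMinimal G Y]
    (hY : IsStateProximal G Y) (hK : Minimal (· ∈ invariantConvexSets G Z) K) (h : C(Z, Y))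
    (hh : ∀ (s : G) z, h (s • z) = s • h z) :
    letI := subAction (closure (K.extremePoints ℝ))
      fun s _ => act_mem_closure_extremePoints hK.prop s
    ∃ f : closure (K.extremePoints ℝ) → Y, Continuous f ∧ Function.Surjective f ∧
      ∀ (s : G) x, f (s • x) = s • f x := by
  let := subAction (closure (K.extremePoints ℝ))
      fun s _ => act_mem_closure_extremePoints hK.prop s
  have := subAction_continuousConstSMul (closure (K.extremePoints ℝ))
      fun s _ => act_mem_closure_extremePoints hK.prop s
  have hKc : IsCompact K := isCompact_stateSpace.of_isClosed_subset hK.prop.2.1 hK.prop.1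
  have hsub := closure_extremePoints_subset hK.prop
  have : CompactSpace (closure (K.extremePoints ℝ)) := isCompact_iff_compactSpace.1
    (hKc.of_isClosed_subset isClosed_closure hsub)
  obtain ⟨k, hk⟩ := hK.prop.2.2.2.1
  obtain ⟨y, hy⟩ := hY (push h k) (push_mem h (hK.prop.1 hk))
  have himg : closure (range fun s : G => act s (push h k)) ⊆ push h '' K := by
    refine closure_minimal (range_subset_iff.2 fun s =>
      ⟨act s k, hK.prop.2.2.2.2 s k hk, push_act h hh s k⟩) ?_
    exact (hKc.image (push h).continuous).isClosed
  have hKY : push h '' K ⊆ stateSpace Y := by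
    rintro _ ⟨φ, hφ, rfl⟩
    exact push_mem h (hK.prop.1 hφ)
  -- A point evaluation is extreme among all states, hence in any subset containing it; extreme
  -- points of the affine image of a compact set lift to extreme points.
  have hyext : pointState y ∈ (push h '' K).extremePoints ℝ :=
    inter_extremePoints_subset_extremePoints_of_subset hKY
      ⟨himg hy, pointState_mem_extremePoints y⟩
  obtain ⟨e, he, hey⟩ := surjOn_extremePoints_image (push h).toContinuousAffineMap hKc
    (show _ ∈ ((push h).toContinuousAffineMap '' K).extremePoints ℝ from hyext)
  replace hey : push h e = pointState y := hey
  have hemb : IsClosedEmbedding (pointState : Y → Functional Y) :=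
    continuous_pointState.isClosedEmbedding pointState_injective
  have hall : ∀ x : closure (K.extremePoints ℝ),
      push h x.1 ∈ range (pointState : Y → Functional Y) := by
    intro x
    -- The functionals pushed to evaluations form a closed invariant set. It contains `e`, so its
    -- orbit closure, and hence every extreme point.
    have h1 : closure (K.extremePoints ℝ) ⊆ push h ⁻¹' range pointState :=
      closure_minimal (fun e' he' => by
        have h2 : closure (range fun t : G => act t e) ⊆ push h ⁻¹' range pointState :=
          closure_minimal (range_subset_iff.2 fun s => ⟨s • y, by
            rw [push_act h hh, hey, act_pointState]⟩)
            (hemb.isClosed_range.preimage (push h).continuous)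
        exact h2 (mem_closure_orbit_of_mem_extremePoints hK (extremePoints_subset he) he'))
        (hemb.isClosed_range.preimage (push h).continuous)
    exact h1 x.2
  choose f hf using hall
  have hfc : Continuous f := by
    rw [hemb.isInducing.continuous_iff]
    have : pointState ∘ f = fun x : closure (K.extremePoints ℝ) => push h x.1 := funext hf
    rw [this]
    exact (push h).continuous.comp continuous_subtype_val
  have hfe : ∀ (s : G) x, f (s • x) = s • f x := fun s x => pointState_injective <| by
    rw [hf, ← act_pointState, hf]
    exact push_act h hh s x.1
  refine ⟨f, hfc, ?_, hfe⟩
  have hcl : IsClosed (range f) := (isCompact_range hfc).isClosed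
  rcases eq_empty_or_univ_of_smul_invariant_closed G hcl (by
    rintro s _ ⟨_, ⟨x, rfl⟩, rfl⟩
    exact ⟨s • x, hfe s x⟩) with h0 | h0
  · exact absurd (show f ⟨e, subset_closure he⟩ ∈ range f from ⟨_, rfl⟩) (by rw [h0]; simp)
  · exact range_eq_univ.1 h0

end Action

/-! ### Strong proximality in terms of states -/

section Measure

open MeasureTheory

variable {X : Type*} [TopologicalSpace X] [MeasurableSpace X] [BorelSpace X]

/-- Integration against a probability measure, as a functional. -/
noncomputable def integralState (ν : ProbabilityMeasure X) : Functional X :=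
  StrongDual.toWeakDual <| LinearMap.mkContinuous
    { toFun := fun f : X →ᵇ ℝ => ∫ x, f x ∂(ν : Measure X)
      map_add' := fun f g => integral_add (f.integrable _) (g.integrable _)
      map_smul' := fun c f => integral_const_mul c _ } 1 fun f => by
    rw [one_mul]
    exact f.norm_integral_le_norm _

theorem integralState_apply (ν : ProbabilityMeasure X) (f : X →ᵇ ℝ) :
    integralState ν f = ∫ x, f x ∂(ν : Measure X) := rfl

theorem integralState_mem (ν : ProbabilityMeasure X) : integralState ν ∈ stateSpace X :=
  ⟨by simp [integralState_apply], fun _ hf => integral_nonneg hf⟩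

/-- Both topologies are pointwise convergence on bounded continuous functions. The map is only
claimed to be inducing: without regularity, distinct measures can define the same functional. -/
theorem isInducing_integralState :
    IsInducing (integralState : ProbabilityMeasure X → Functional X) := by
  refine isInducing_iff_nhds.2 fun ν => le_antisymm ?_ ?_
  · refine map_le_iff_le_comap.1 ?_
    refine tendsto_iff_forall_eval_tendsto_topDualPairing.2 fun f => ?_
    exact (ProbabilityMeasure.tendsto_iff_forall_integral_tendsto
      (μs := (id : ProbabilityMeasure X → ProbabilityMeasure X))).1 tendsto_id f
  · rw [← tendsto_id']
    refine (ProbabilityMeasure.tendsto_iff_forall_integral_tendsto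
      (μs := (id : ProbabilityMeasure X → ProbabilityMeasure X))).2 fun f => ?_
    exact ((WeakDual.eval_continuous f).tendsto (integralState ν)).comp tendsto_comap

theorem integralState_diracProba [T1Space X] (x : X) :
    integralState (diracProba x) = pointState x := by
  refine DFunLike.ext _ _ fun f => ?_
  rw [integralState_apply, pointState_apply]
  exact integral_dirac _ _

theorem integralState_map {G : Type*} [Group G] [MulAction G X] [ContinuousConstSMul G X] (s : G)
    (ν : ProbabilityMeasure X) :
    integralState
      (ν.map (f := fun y : X => s • y) (continuous_const_smul s).measurable.aemeasurable) =
      act s (integralState ν) := by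
  refine DFunLike.ext _ _ fun f => ?_
  exact integral_map (continuous_const_smul s).measurable.aemeasurable
    f.continuous.measurable.aestronglyMeasurable

/-- Riesz–Markov–Kakutani; compact support is automatic, and `φ 1 = 1` gives total mass one. -/
theorem exists_regular_integralState_eq [CompactSpace X] [T2Space X] {φ : Functional X}
    (hφ : φ ∈ stateSpace X) :
    ∃ ν : ProbabilityMeasure X, (ν : Measure X).Regular ∧ integralState ν = φ := by
  let Λ : CompactlySupportedContinuousMap X ℝ →ₚ[ℝ] ℝ := PositiveLinearMap.mk₀
    { toFun := fun f => φ (BoundedContinuousFunction.mkOfCompact f.toContinuousMap)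
      map_add' := fun f g => map_add φ (BoundedContinuousFunction.mkOfCompact f.toContinuousMap)
        (BoundedContinuousFunction.mkOfCompact g.toContinuousMap)
      map_smul' := fun c f =>
        map_smul φ c (BoundedContinuousFunction.mkOfCompact f.toContinuousMap) }
    fun f hf => hφ.2 _ fun x => hf x
  have key : ∀ g : X →ᵇ ℝ, ∫ x, g x ∂(RealRMK.rieszMeasure Λ) = φ g := fun g => by
    let g' : CompactlySupportedContinuousMap X ℝ :=
      { toFun := g, hasCompactSupport' := HasCompactSupport.of_compactSpace _ }
    exact RealRMK.integral_rieszMeasure Λ g'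
  have hprob : IsProbabilityMeasure (RealRMK.rieszMeasure Λ) := by
    have h1 := key 1
    rw [hφ.1] at h1
    simp only [BoundedContinuousFunction.coe_one, Pi.one_apply, integral_const, smul_eq_mul,
      mul_one] at h1
    refine ⟨?_⟩
    rw [Measure.real, ENNReal.toReal_eq_one_iff] at h1
    exact h1
  exact ⟨⟨RealRMK.rieszMeasure Λ, hprob⟩, inferInstanceAs (RealRMK.rieszMeasure Λ).Regular,
    DFunLike.ext _ _ key⟩

end Measure

theorem isStronglyProximal_iff {G : Type u} [Group G] {X : Type u} [TopologicalSpace X]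
    [MulAction G X] [ContinuousConstSMul G X] [CompactSpace X] [T2Space X] :
    IsStronglyProximal G X ↔ IsStateProximal G X := by
  let : MeasurableSpace X := borel X
  have : BorelSpace X := ⟨rfl⟩
  have key : ∀ (ν : MeasureTheory.ProbabilityMeasure X) (x : X),
      MeasureTheory.diracProba x ∈ closure (range fun s : G =>
        ν.map (f := fun y : X => s • y) (continuous_const_smul s).measurable.aemeasurable) ↔
      pointState x ∈ closure (range fun s : G => act s (integralState ν)) := by
    intro ν x
    rw [isInducing_integralState.closure_eq_preimage_closure_image, mem_preimage, ← range_comp,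
      integralState_diracProba]
    simp only [Function.comp_def, integralState_map]
  constructor
  · intro h φ hφ
    obtain ⟨ν, hν, rfl⟩ := exists_regular_integralState_eq hφ
    obtain ⟨x, hx⟩ := h ν hν
    exact ⟨x, (key ν x).1 hx⟩
  · intro h ν _
    obtain ⟨x, hx⟩ := h _ (integralState_mem ν)
    exact ⟨x, (key ν x).2 hx⟩

/-! ### Existence of the Furstenberg boundary -/

section Existence

variable {G : Type u} [Group G]

/-- Universality uses discreteness of `G`: each orbit map `s ↦ s • y` into a boundary is continuous
and equivariant. -/
theorem isFurstenbergBoundary_closure_extremePoints [TopologicalSpace G] [DiscreteTopology G]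
    {K : Set (Functional G)} (hK : Minimal (· ∈ invariantConvexSets G G) K) :
    letI := subAction (closure (K.extremePoints ℝ))
      fun s _ => act_mem_closure_extremePoints hK.prop s
    haveI := subAction_continuousConstSMul (closure (K.extremePoints ℝ))
      fun s _ => act_mem_closure_extremePoints hK.prop s
    IsFurstenbergBoundary G (closure (K.extremePoints ℝ)) := by
  let := subAction (closure (K.extremePoints ℝ))
      fun s _ => act_mem_closure_extremePoints hK.prop s
  have := subAction_continuousConstSMul (closure (K.extremePoints ℝ))
      fun s _ => act_mem_closure_extremePoints hK.prop s
  have hKc : IsCompact K := isCompact_stateSpace.of_isClosed_subset hK.prop.2.1 hK.prop.1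
  have hcomp : CompactSpace (closure (K.extremePoints ℝ)) := isCompact_iff_compactSpace.1
    (hKc.of_isClosed_subset isClosed_closure (closure_extremePoints_subset hK.prop))
  refine ⟨⟨hcomp, inferInstance, ?_, isMinimal_closure_extremePoints hK,
    isStronglyProximal_iff.2 (isStateProximal_closure_extremePoints hK)⟩, ?_⟩
  · exact ((hKc.extremePoints_nonempty hK.prop.2.2.2.1).mono subset_closure).to_subtype
  · intro Y _ _ _ hY
    have := hY.compact
    have := hY.hausdorff
    have := hY.minimal
    obtain ⟨y⟩ := hY.nonempty
    exact exists_equivariant_map (isStronglyProximal_iff.1 hY.stronglyProximal) hK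
      ⟨fun s => s • y, continuous_of_discreteTopology⟩ fun s t => mul_smul s t y

/-- A state on the bounded functions on `G` that is fixed by `G` gives an invariant mean. -/
theorem isAmenable_of_fixed_state [TopologicalSpace G] [DiscreteTopology G] {φ : Functional G}
    (hφ : φ ∈ stateSpace G) (hfix : ∀ s : G, act s φ = φ) : IsAmenable G := by
  have hbd : ∀ f : lp (fun _ : G => ℂ) ∞, ∀ t, ‖f t‖ ≤ ‖f‖ := fun f t =>
    lp.norm_apply_le_norm ENNReal.top_ne_zero f t
  let re : lp (fun _ : G => ℂ) ∞ → (G →ᵇ ℝ) := fun f =>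
    BoundedContinuousFunction.ofNormedAddCommGroup (fun t => (f t).re)
      continuous_of_discreteTopology ‖f‖ fun t => (Complex.abs_re_le_norm _).trans (hbd f t)
  let im : lp (fun _ : G => ℂ) ∞ → (G →ᵇ ℝ) := fun f =>
    BoundedContinuousFunction.ofNormedAddCommGroup (fun t => (f t).im)
      continuous_of_discreteTopology ‖f‖ fun t => (Complex.abs_im_le_norm _).trans (hbd f t)
  have hre : ∀ f t, re f t = (f t).re := fun _ _ => rfl
  have him : ∀ f t, im f t = (f t).im := fun _ _ => rfl
  -- The complex mean is the complexification of the real state.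
  refine ⟨{ toFun := fun f => ⟨φ (re f), φ (im f)⟩, map_add' := ?_, map_smul' := ?_ }, ?_, ?_, ?_⟩
  · intro f g
    have h1 : re (f + g) = re f + re g := by ext t; simp [hre]
    have h2 : im (f + g) = im f + im g := by ext t; simp [him]
    rw [h1, h2, map_add, map_add]
    rfl
  · intro c f
    have h1 : re (c • f) = c.re • re f - c.im • im f := by ext t; simp [hre, him]
    have h2 : im (c • f) = c.re • im f + c.im • re f := by ext t; simp [hre, him]
    rw [h1, h2, map_add, map_sub, map_smul, map_smul, map_smul, map_smul]
    rfl
  · have h1 : re 1 = 1 := by ext t; simp [hre]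
    have h2 : im 1 = 0 := by ext t; simp [him]
    change (⟨φ (re 1), φ (im 1)⟩ : ℂ) = 1
    rw [h1, h2, map_zero, hφ.1]
    rfl
  · intro f hf
    have h2 : im f = 0 := by ext t; exact (Complex.nonneg_iff.1 (hf t)).2.symm
    change 0 ≤ (⟨φ (re f), φ (im f)⟩ : ℂ)
    rw [h2, map_zero]
    exact Complex.nonneg_iff.2 ⟨hφ.2 _ fun t => (Complex.nonneg_iff.1 (hf t)).1, rfl⟩
  · intro s f g hfg
    have key : ∀ a b : G →ᵇ ℝ, (∀ t, a t = b (s⁻¹ * t)) → φ a = φ b := by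
      intro a b hab
      rw [← DFunLike.congr_fun (hfix s⁻¹) b]
      refine congrArg φ ?_
      ext t
      exact hab t
    change (⟨φ (re g), φ (im g)⟩ : ℂ) = ⟨φ (re f), φ (im f)⟩
    rw [key (re g) (re f) fun t => by rw [hre, hre, hfg],
      key (im g) (im f) fun t => by rw [him, him, hfg]]

variable (G) in
theorem exists_isFurstenbergBoundary :
    ∃ (X : Type u) (_ : TopologicalSpace X) (_ : MulAction G X) (_ : ContinuousConstSMul G X),
      IsFurstenbergBoundary G X := by
  let : TopologicalSpace G := ⊥
  have : DiscreteTopology G := ⟨rfl⟩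
  obtain ⟨K, hK⟩ := exists_minimal_invariantConvexSets G (Z := G)
  exact ⟨_, _, _, _, isFurstenbergBoundary_closure_extremePoints hK⟩

/-- Universality maps `X` equivariantly onto a space of states on the bounded functions on `G`; a
global fixed point would become an invariant mean. -/
theorem IsFurstenbergBoundary.exists_smul_ne {X : Type u} [TopologicalSpace X] [MulAction G X]
    [ContinuousConstSMul G X] (hX : IsFurstenbergBoundary G X) (hna : ¬ IsAmenable G) (x : X) :
    ∃ s : G, s • x ≠ x := by
  by_contra! hfix
  let : TopologicalSpace G := ⊥
  have : DiscreteTopology G := ⟨rfl⟩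
  obtain ⟨K, hK⟩ := exists_minimal_invariantConvexSets G (Z := G)
  let := subAction (closure (K.extremePoints ℝ))
      fun s _ => act_mem_closure_extremePoints hK.prop s
  have := subAction_continuousConstSMul (closure (K.extremePoints ℝ))
      fun s _ => act_mem_closure_extremePoints hK.prop s
  obtain ⟨f, -, -, hf⟩ := hX.universal _ (isFurstenbergBoundary_closure_extremePoints hK).isBoundary
  refine hna (isAmenable_of_fixed_state (φ := (f x).1)
    (hK.prop.1 (closure_extremePoints_subset hK.prop (f x).2)) fun s => ?_)
  have := hf s x
  rw [hfix s] at this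
  exact (congrArg Subtype.val this).symm

end Existence

/-! ### Topological freeness -/

section Free

variable {G : Type u} [Group G] {p : ℕ}

theorem IsTarskiMonster.finite_of_ne_top (hG : IsTarskiMonster G p) {H : Subgroup G}
    (hH : H ≠ ⊤) : Finite H := by
  rcases eq_or_ne H ⊥ with rfl | hb
  · infer_instance
  · exact Nat.finite_of_card_ne_zero ((hG.cyclic H hb hH).2 ▸ hG.prime.ne_zero)

/-- An element with finite conjugacy class is central. -/
theorem IsTarskiMonster.centralizer_eq_top (hG : IsTarskiMonster G p) {s : G}
    (hs : (MulAction.orbit (ConjAct G) s).Finite) : Subgroup.centralizer {s} = ⊤ := by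
  by_contra hne
  have hinf := hG.infinite
  have hfin := hG.finite_of_ne_top hne
  -- Orbit–stabilizer for conjugation; a finite subgroup of finite index would make `G` finite.
  have hindex : (Subgroup.centralizer {s}).FiniteIndex := by
    have : Finite (MulAction.orbit (ConjAct G) s) := hs
    have h1 : Finite (ConjAct G ⧸ MulAction.stabilizer (ConjAct G) s) :=
      Finite.of_equiv _ (MulAction.orbitEquivQuotientStabilizer (ConjAct G) s)
    have h2 : (MulAction.stabilizer (ConjAct G) s).FiniteIndex :=
      Subgroup.finiteIndex_of_finite_quotient
    rw [ConjAct.stabilizer_eq_centralizer] at h2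
    exact h2
  exact not_finite_iff_infinite.2 hinf
    ((Subgroup.finite_iff_finite_and_finiteIndex (Subgroup.centralizer {s})).2 ⟨hfin, hindex⟩)

/-- In a Tarski monster, no nontrivial element generating a proper subgroup is central. -/
theorem IsTarskiMonster.centralizer_ne_top (hG : IsTarskiMonster G p) {s : G} (hs : s ≠ 1)
    (hst : Subgroup.zpowers s ≠ ⊤) : Subgroup.centralizer {s} ≠ ⊤ := by
  intro hc
  have hinf := hG.infinite
  have hcomm : ∀ g, s * g = g * s := fun g =>
    (Subgroup.mem_centralizer_singleton_iff.1 (hc ▸ Subgroup.mem_top g)).symm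
  have hfs : Finite (Subgroup.zpowers s) := hG.finite_of_ne_top hst
  obtain ⟨t, ht⟩ : ∃ t, t ∉ Subgroup.zpowers s := by
    by_contra! h
    exact hst ((Subgroup.eq_top_iff' _).2 h)
  have hsb : Subgroup.zpowers s ≠ ⊥ := by simpa using hs
  -- If the join were proper it would also have order `p`, so it would equal `zpowers s` and contain
  -- `t`.
  have htop : Subgroup.zpowers s ⊔ Subgroup.zpowers t = ⊤ := by
    by_contra hne
    have hle : Subgroup.zpowers s ≤ Subgroup.zpowers s ⊔ Subgroup.zpowers t := le_sup_left
    have := hG.finite_of_ne_top hne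
    have h1 := (hG.cyclic _ hsb hst).2
    have h2 := (hG.cyclic _ (ne_bot_of_le_ne_bot hsb hle) hne).2
    have heq := Subgroup.eq_of_le_of_card_ge hle (by rw [h1, h2])
    exact ht (heq ▸ (le_sup_right : Subgroup.zpowers t ≤ _) (Subgroup.mem_zpowers t))
  -- If `t` generates `G`, then `s` is a nonzero power of `t`, and the finite order of `s` passes to
  -- `t`.
  have hft : Finite (Subgroup.zpowers t) := by
    by_cases h : Subgroup.zpowers t = ⊤
    · obtain ⟨k, hk⟩ := Subgroup.mem_zpowers_iff.1 (h ▸ Subgroup.mem_top s)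
      obtain ⟨n, hn, hsn⟩ := (isOfFinOrder_iff_pow_eq_one.1 (finite_zpowers.1 hfs))
      have hk0 : k ≠ 0 := by
        rintro rfl
        exact hs (by rw [← hk, zpow_zero])
      refine finite_zpowers.2 (isOfFinOrder_iff_zpow_eq_one.2
        ⟨k * n, mul_ne_zero hk0 (by exact_mod_cast hn.ne'), ?_⟩)
      rw [zpow_mul, hk, zpow_natCast, hsn]
    · exact hG.finite_of_ne_top h
  have hnormal : (Subgroup.zpowers s).Normal := by
    refine ⟨fun n hn g => ?_⟩
    obtain ⟨k, rfl⟩ := Subgroup.mem_zpowers_iff.1 hn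
    have : Commute g (s ^ k) := Commute.zpow_right (hcomm g).symm k
    rw [this.eq, mul_inv_cancel_right]
    exact hn
  have huniv : ((Subgroup.zpowers s : Set G) * (Subgroup.zpowers t : Set G)) = univ := by
    rw [← Subgroup.normal_mul, htop]
    rfl
  have hfin : (univ : Set G).Finite :=
    huniv ▸ Set.Finite.mul (Set.toFinite (Subgroup.zpowers s : Set G))
      (Set.toFinite (Subgroup.zpowers t : Set G))
  exact Set.infinite_univ hfin

/-- A minimal action of a Tarski monster on a compact space without fixed points is
topologically free. -/
theorem IsTarskiMonster.isTopologicallyFree (hG : IsTarskiMonster G p) {X : Type u}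
    [TopologicalSpace X] [MulAction G X] [ContinuousConstSMul G X] [CompactSpace X]
    [MulAction.IsMinimal G X] (hfix : ∀ x : X, ∃ s : G, s • x ≠ x) : IsTopologicallyFree G X := by
  intro s hs
  by_contra hd
  have hU : (interior {x : X | s • x = x}).Nonempty := by
    rw [nonempty_iff_ne_empty]
    exact fun h => hd (interior_eq_empty_iff_dense_compl.1 h)
  have hsU : ∀ u ∈ interior {x : X | s • x = x}, s ∈ MulAction.stabilizer G u :=
    fun u hu => MulAction.mem_stabilizer_iff.2 (interior_subset hu : u ∈ {x : X | s • x = x})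
  have hstab : ∀ u : X, MulAction.stabilizer G u ≠ ⊤ := fun u h => by
    obtain ⟨g, hg⟩ := hfix u
    exact hg (h ▸ Subgroup.mem_top g : g ∈ MulAction.stabilizer G u)
  have hzs : ∀ u ∈ interior {x : X | s • x = x}, Subgroup.zpowers s ≤ MulAction.stabilizer G u :=
    fun u hu => Subgroup.zpowers_le.2 (hsU u hu)
  have hsb : Subgroup.zpowers s ≠ ⊥ := by simpa using hs
  have hst : Subgroup.zpowers s ≠ ⊤ := by
    obtain ⟨u, hu⟩ := hU
    exact ne_top_of_le_ne_top (hstab u) (hzs u hu)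
  have hfin := hG.finite_of_ne_top hst
  -- Both groups are nontrivial and proper, so both have order `p`.
  have heq : ∀ u ∈ interior {x : X | s • x = x},
      Subgroup.zpowers s = MulAction.stabilizer G u := fun u hu => by
    have := hG.finite_of_ne_top (hstab u)
    refine Subgroup.eq_of_le_of_card_ge (hzs u hu) ?_
    rw [(hG.cyclic _ hsb hst).2, (hG.cyclic _ (ne_bot_of_le_ne_bot hsb (hzs u hu)) (hstab u)).2]
  obtain ⟨I, hI⟩ := isCompact_univ.exists_finite_cover_smul G isOpen_interior hU
  refine hG.centralizer_ne_top hs hst (hG.centralizer_eq_top ?_)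
  obtain ⟨u₀, hu₀⟩ := hU
  -- The conjugate of `s` by `g` fixes `g u₀ = t u` with `u` in the open set and `t ∈ I`, so it lies
  -- in the conjugate of `zpowers s` by `t`: finitely many possibilities.
  refine Set.Finite.subset (Set.Finite.biUnion I.finite_toSet fun t _ =>
    (Set.toFinite (Subgroup.zpowers s : Set G)).image fun h => t * h * t⁻¹) ?_
  rintro _ ⟨g, rfl⟩
  obtain ⟨t, ht, u, hu, htu⟩ := mem_iUnion₂.1 (hI (mem_univ (ConjAct.ofConjAct g • u₀)))
  have htu' : t • u = ConjAct.ofConjAct g • u₀ := htu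
  refine mem_iUnion₂.2 ⟨t, ht, t⁻¹ * (g • s) * t, ?_, by group⟩
  rw [SetLike.mem_coe, heq u hu, MulAction.mem_stabilizer_iff, ConjAct.smul_def, mul_smul, htu',
    mul_smul, mul_smul, mul_smul, inv_smul_smul, show s • u₀ = u₀ from hsU u₀ hu₀, ← htu',
    inv_smul_smul]

end Free

/-! ### Multiplication operators on `ℓ²(G)` -/

section Operators

variable {G : Type u}

theorem hasSum_ell2_norm_sq (ξ : ell2 G) : HasSum (fun t => ‖ξ t‖ ^ 2) (‖ξ‖ ^ 2) := by
  have h := lp.hasSum_norm (p := 2) (by norm_num) ξ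
  simpa using h

theorem ell2_norm_sq_add_le {ξ η ζ : ell2 G} {a b c : ℝ}
    (h : ∀ t, a * ‖ξ t‖ ^ 2 + b * ‖η t‖ ^ 2 ≤ c * ‖ζ t‖ ^ 2) :
    a * ‖ξ‖ ^ 2 + b * ‖η‖ ^ 2 ≤ c * ‖ζ‖ ^ 2 :=
  hasSum_le h (((hasSum_ell2_norm_sq ξ).mul_left a).add ((hasSum_ell2_norm_sq η).mul_left b))
    ((hasSum_ell2_norm_sq ζ).mul_left c)

theorem ell2_norm_sq_le_add {ξ η ζ : ell2 G} {b : ℝ}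
    (h : ∀ t, ‖ζ t‖ ^ 2 ≤ ‖ξ t‖ ^ 2 + b * ‖η t‖ ^ 2) : ‖ζ‖ ^ 2 ≤ ‖ξ‖ ^ 2 + b * ‖η‖ ^ 2 :=
  hasSum_le h (hasSum_ell2_norm_sq ζ) ((hasSum_ell2_norm_sq ξ).add
    ((hasSum_ell2_norm_sq η).mul_left b))

theorem ell2_norm_le_mul {ξ ζ : ell2 G} {C : ℝ} (hC : 0 ≤ C) (h : ∀ t, ‖ζ t‖ ≤ C * ‖ξ t‖) :
    ‖ζ‖ ≤ C * ‖ξ‖ := by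
  refine (sq_le_sq₀ (norm_nonneg _) (by positivity)).1 ?_
  rw [mul_pow]
  refine hasSum_le (fun t => ?_) (hasSum_ell2_norm_sq ζ) ((hasSum_ell2_norm_sq ξ).mul_left (C ^ 2))
  rw [← mul_pow]
  exact (sq_le_sq₀ (norm_nonneg _) (mul_nonneg hC (norm_nonneg _))).2 (h t)

variable [Group G] {X : Type*} [TopologicalSpace X] [MulAction G X]

theorem memlp_mul (x₀ : X) (f : X →ᵇ ℝ) (ξ : ell2 G) :
    Memℓp (fun t : G => (f (t • x₀) : ℂ) * ξ t) 2 := by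
  refine Memℓp.mono ((lp.memℓp ξ).norm.const_mul ‖f‖) fun t => ?_
  rw [norm_mul, Complex.norm_real]
  exact mul_le_mul_of_nonneg_right (f.norm_coe_le_norm _) (norm_nonneg _)

/-- Multiplication by the restriction of `f` to the orbit of `x₀`, as an operator on `ℓ²(G)`. -/
noncomputable def mulOp (x₀ : X) (f : X →ᵇ ℝ) : ell2 G →L[ℂ] ell2 G :=
  LinearMap.mkContinuous
    { toFun := fun ξ => ⟨fun t => (f (t • x₀) : ℂ) * ξ t, memlp_mul x₀ f ξ⟩
      map_add' := fun ξ η => by ext t; exact mul_add _ (ξ t) (η t)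
      map_smul' := fun c ξ => by ext t; exact mul_left_comm _ c (ξ t) } ‖f‖ fun ξ =>
    ell2_norm_le_mul (norm_nonneg f) fun t => by
      change ‖(f (t • x₀) : ℂ) * ξ t‖ ≤ _
      rw [norm_mul, Complex.norm_real]
      exact mul_le_mul_of_nonneg_right (f.norm_coe_le_norm _) (norm_nonneg _)

theorem mulOp_apply (x₀ : X) (f : X →ᵇ ℝ) (ξ : ell2 G) (t : G) :
    mulOp x₀ f ξ t = (f (t • x₀) : ℂ) * ξ t := rfl

theorem norm_mulOp_le (x₀ : X) (f : X →ᵇ ℝ) : ‖mulOp (G := G) x₀ f‖ ≤ ‖f‖ :=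
  LinearMap.mkContinuous_norm_le _ (norm_nonneg f) _

/-- The linear map `f ↦ M_f`. -/
noncomputable def mulOpCLM (x₀ : X) : (X →ᵇ ℝ) →L[ℝ] (ell2 G →L[ℂ] ell2 G) :=
  LinearMap.mkContinuous
    { toFun := mulOp x₀
      map_add' := fun f g => by
        ext ξ t
        change ((f (t • x₀) + g (t • x₀) : ℝ) : ℂ) * ξ t = f (t • x₀) * ξ t + g (t • x₀) * ξ t
        push_cast
        ring
      map_smul' := fun c f => by
        ext ξ t
        change ((c * f (t • x₀) : ℝ) : ℂ) * ξ t = (c : ℂ) * (f (t • x₀) * ξ t)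
        push_cast
        ring } 1 fun f => by
    rw [one_mul]
    exact norm_mulOp_le x₀ f

theorem mulOp_one (x₀ : X) : mulOp (G := G) x₀ 1 = 1 := by
  ext ξ t
  rw [mulOp_apply]
  simp

theorem leftRegular_apply (s : G) (ξ : ell2 G) (t : G) : leftRegular s ξ t = ξ (s⁻¹ * t) := rfl

theorem leftRegular_mul (s t : G) : leftRegular s * leftRegular t = leftRegular (s * t) := by
  ext ξ r
  change ξ (t⁻¹ * (s⁻¹ * r)) = ξ ((s * t)⁻¹ * r)
  rw [mul_inv_rev, mul_assoc]

theorem leftRegular_one : leftRegular (1 : G) = 1 := by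
  ext ξ r
  rw [leftRegular_apply, inv_one, one_mul]
  rfl

theorem star_leftRegular (s : G) : star (leftRegular s) = leftRegular s⁻¹ := by
  have h1 : star (leftRegular s) * leftRegular s = 1 :=
    (ContinuousLinearMap.norm_map_iff_adjoint_comp_self _).1 (leftRegularIsometry s).norm_map
  have h2 : leftRegular s * leftRegular s⁻¹ = 1 := by
    rw [leftRegular_mul, mul_inv_cancel, leftRegular_one]
  exact left_inv_eq_right_inv h1 h2

theorem norm_leftRegular_le (s : G) : ‖leftRegular s‖ ≤ 1 :=
  LinearIsometry.norm_toContinuousLinearMap_le _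

theorem mulOp_mul_leftRegular [ContinuousConstSMul G X] (x₀ : X) (f : X →ᵇ ℝ) (s : G) :
    mulOp x₀ f * leftRegular s =
      leftRegular s * mulOp x₀ (pullback ⟨fun x => s • x, continuous_const_smul s⟩ f) := by
  ext ξ t
  change (f (t • x₀) : ℂ) * ξ (s⁻¹ * t) = (f (s • (s⁻¹ * t) • x₀) : ℂ) * ξ (s⁻¹ * t)
  rw [smul_smul, mul_inv_cancel_left]

theorem leftRegular_inv_mul_mulOp_mul_leftRegular [ContinuousConstSMul G X] (x₀ : X)
    (f : X →ᵇ ℝ) (s : G) : leftRegular s⁻¹ * mulOp x₀ f * leftRegular s =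
      mulOp x₀ (pullback ⟨fun x => s • x, continuous_const_smul s⟩ f) := by
  rw [mul_assoc, mulOp_mul_leftRegular, ← mul_assoc, leftRegular_mul, inv_mul_cancel,
    leftRegular_one, one_mul]

theorem norm_sq_ofReal_mul_le {r : ℝ} (z : ℂ) (hr : |r| ≤ 1) : ‖(r : ℂ) * z‖ ^ 2 ≤ ‖z‖ ^ 2 := by
  rw [norm_mul, Complex.norm_real]
  exact pow_le_pow_left₀ (by positivity) (mul_le_of_le_one_left (norm_nonneg z) hr) 2

/-- Operators with orthogonal ranges: if `a` and `b` have disjoint supports and are bounded by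
one, then `‖M_a + M_b T‖² ≤ 1 + ‖T‖²`. -/
theorem norm_sq_mulOp_add_mulOp_mul_le (x₀ : X) {a b : X →ᵇ ℝ} (ha : ∀ x, |a x| ≤ 1)
    (hb : ∀ x, |b x| ≤ 1) (hab : ∀ x, a x = 0 ∨ b x = 0) (T : ell2 G →L[ℂ] ell2 G) :
    ‖mulOp x₀ a + mulOp x₀ b * T‖ ^ 2 ≤ 1 + ‖T‖ ^ 2 := by
  have key : ‖mulOp x₀ a + mulOp x₀ b * T‖ ≤ √(1 + ‖T‖ ^ 2) := by
    refine ContinuousLinearMap.opNorm_le_bound _ (Real.sqrt_nonneg _) fun ξ => ?_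
    have h : ‖(mulOp x₀ a + mulOp x₀ b * T : ell2 G →L[ℂ] ell2 G) ξ‖ ^ 2 ≤
        ‖ξ‖ ^ 2 + 1 * ‖T ξ‖ ^ 2 := by
      refine ell2_norm_sq_le_add fun t => ?_
      change ‖(a (t • x₀) : ℂ) * ξ t + (b (t • x₀) : ℂ) * (T ξ) t‖ ^ 2 ≤ _
      rcases hab (t • x₀) with h | h
      · rw [h, Complex.ofReal_zero, zero_mul, zero_add]
        have := norm_sq_ofReal_mul_le (T ξ t) (hb (t • x₀))
        nlinarith [sq_nonneg ‖ξ t‖]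
      · rw [h, Complex.ofReal_zero, zero_mul, add_zero]
        have := norm_sq_ofReal_mul_le (ξ t) (ha (t • x₀))
        nlinarith [sq_nonneg ‖T ξ t‖]
    refine (sq_le_sq₀ (norm_nonneg _) (by positivity)).1 (h.trans ?_)
    rw [mul_pow, Real.sq_sqrt (by positivity)]
    have := pow_le_pow_left₀ (norm_nonneg _) (T.le_opNorm ξ) 2
    rw [mul_pow] at this
    linarith
  calc _ ≤ √(1 + ‖T‖ ^ 2) ^ 2 := pow_le_pow_left₀ (norm_nonneg _) key 2
    _ = _ := Real.sq_sqrt (by positivity)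

/-- Here disjoint supports act on the input side: `‖M_a ξ‖² + ‖M_b ξ‖² ≤ ‖ξ‖²`, and Cauchy–Schwarz
finishes. -/
theorem norm_sq_mulOp_add_mul_mulOp_le (x₀ : X) {a b : X →ᵇ ℝ} (ha : ∀ x, |a x| ≤ 1)
    (hb : ∀ x, |b x| ≤ 1) (hab : ∀ x, a x = 0 ∨ b x = 0) (T : ell2 G →L[ℂ] ell2 G) :
    ‖mulOp x₀ a + T * mulOp x₀ b‖ ^ 2 ≤ 1 + ‖T‖ ^ 2 := by
  have key : ‖mulOp x₀ a + T * mulOp x₀ b‖ ≤ √(1 + ‖T‖ ^ 2) := by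
    refine ContinuousLinearMap.opNorm_le_bound _ (Real.sqrt_nonneg _) fun ξ => ?_
    have h : 1 * ‖mulOp x₀ a ξ‖ ^ 2 + 1 * ‖mulOp x₀ b ξ‖ ^ 2 ≤ 1 * ‖ξ‖ ^ 2 := by
      refine ell2_norm_sq_add_le fun t => ?_
      rw [mulOp_apply, mulOp_apply]
      rcases hab (t • x₀) with h | h
      · rw [h]
        have := norm_sq_ofReal_mul_le (ξ t) (hb (t • x₀))
        simpa using this
      · rw [h]
        have := norm_sq_ofReal_mul_le (ξ t) (ha (t • x₀))
        simpa using this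
    have h2 : ‖(mulOp x₀ a + T * mulOp x₀ b : ell2 G →L[ℂ] ell2 G) ξ‖ ≤
        ‖mulOp x₀ a ξ‖ + ‖T‖ * ‖mulOp x₀ b ξ‖ :=
      (norm_add_le _ _).trans (add_le_add_right (T.le_opNorm _) _)
    refine h2.trans ((sq_le_sq₀ (by positivity) (by positivity)).1 ?_)
    rw [mul_pow, Real.sq_sqrt (by positivity)]
    have h3 : 0 ≤ (1 + ‖T‖ ^ 2) := by positivity
    nlinarith [sq_nonneg (‖T‖ * ‖mulOp x₀ a ξ‖ - ‖mulOp x₀ b ξ‖)]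
  calc _ ≤ √(1 + ‖T‖ ^ 2) ^ 2 := pow_le_pow_left₀ (norm_nonneg _) key 2
    _ = _ := Real.sq_sqrt (by positivity)

/-- If `φ` attains its norm at `A` and `S` is orthogonal to `A` in the sense of the norm, then `φ`
vanishes at `S`. -/
theorem apply_eq_zero_of_norm_sq_add_smul_le {E : Type*} [NormedAddCommGroup E] [NormedSpace ℂ E]
    {φ : E →L[ℂ] ℂ} (hφ : ‖φ‖ ≤ 1) {A S : E} (hA : (φ A).re = 1) {N : ℝ}
    (h : ∀ z : ℂ, ‖A + z • S‖ ^ 2 ≤ 1 + (‖z‖ * N) ^ 2) : φ S = 0 := by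
  by_contra hne
  have hc : 0 < ‖φ S‖ := norm_pos_iff.2 hne
  set c := ‖φ S‖
  have hN : 0 < N ^ 2 + 1 := by positivity
  -- Choosing `z = r · conj (φ S)` makes the real part `1 + r c²`, whose square exceeds `1 + 2 r
  -- c²`, while the hypothesis allows only `1 + r² c² N²`. The choice of `r` ensures `r N² < 1`.
  set r : ℝ := (N ^ 2 + 1)⁻¹ with hr
  have hr0 : 0 < r := inv_pos.2 hN
  set z : ℂ := (r : ℂ) * (starRingEnd ℂ) (φ S) with hz
  have hzn : ‖z‖ = r * c := by
    rw [hz, norm_mul, Complex.norm_real, RCLike.norm_conj, Real.norm_of_nonneg hr0.le]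
  have hre : (φ (A + z • S)).re = 1 + r * c ^ 2 := by
    rw [map_add, map_smul, Complex.add_re, hA, smul_eq_mul, hz, mul_assoc,
      ← Complex.normSq_eq_conj_mul_self, Complex.normSq_eq_norm_sq, ← Complex.ofReal_mul,
      Complex.ofReal_re]
  have h1 : 1 + r * c ^ 2 ≤ ‖A + z • S‖ := by
    rw [← hre]
    exact (Complex.re_le_norm _).trans ((φ.le_opNorm _).trans
      (mul_le_of_le_one_left (norm_nonneg _) hφ))
  have h2 : (1 + r * c ^ 2) ^ 2 ≤ 1 + (r * c * N) ^ 2 := by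
    rw [← hzn]
    exact (pow_le_pow_left₀ (by positivity) h1 2).trans (h z)
  have h3 : r * N ^ 2 < 1 := by
    rw [hr, inv_mul_lt_iff₀ hN]
    linarith
  have h4 : 0 < r * c ^ 2 := by positivity
  nlinarith [mul_lt_mul_of_pos_left h3 h4, sq_nonneg (r * c ^ 2)]

end Operators

/-! ### C*-simplicity -/

section Simple

variable {G : Type u}

theorem eq_zero_of_apply_single {T : ell2 G →L[ℂ] ell2 G}
    (h : open Classical in ∀ t : G, T (lp.single 2 t (1 : ℂ)) = 0) : T = 0 := by
  classical
  ext1 ξ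
  have h1 := (lp.hasSum_single (p := 2) (by norm_num) ξ).mapL T
  refine h1.unique ?_
  change HasSum _ (0 : ell2 G)
  convert hasSum_zero with t
  have : lp.single 2 t (ξ t) = ξ t • (lp.single 2 t (1 : ℂ) : ell2 G) := by
    rw [← lp.single_smul, smul_eq_mul, mul_one]
  rw [this, map_smul, h, smul_zero]

variable [Group G]

theorem leftRegular_mem (s : G) : leftRegular s ∈ reducedCStarAlgebra G :=
  StarSubalgebra.le_topologicalClosure _ (StarAlgebra.subset_adjoin ℂ _ ⟨s, rfl⟩)

/-- A proper two-sided ideal of the reduced C*-algebra is annihilated by a functional on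
`B(ℓ²(G))` of norm at most one that takes the value one at the identity. -/
theorem exists_functional_of_ne_top {I : TwoSidedIdeal (reducedCStarAlgebra G)} (hI : I ≠ ⊤) :
    ∃ φ : (ell2 G →L[ℂ] ell2 G) →L[ℂ] ℂ, ‖φ‖ ≤ 1 ∧ φ 1 = 1 ∧ ∀ a ∈ I, φ a.1 = 0 := by
  have hcl : IsClosed (reducedCStarAlgebra G : Set (ell2 G →L[ℂ] ell2 G)) :=
    StarSubalgebra.isClosed_topologicalClosure _
  have hcomp : CompleteSpace (reducedCStarAlgebra G) := hcl.completeSpace_coe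
  -- An element at distance less than one from the identity is invertible (Neumann series), and a
  -- proper ideal contains no unit.
  have hdist : ∀ a ∈ I, 1 ≤ ‖(1 : ell2 G →L[ℂ] ell2 G) - a.1‖ := by
    intro a ha
    by_contra! hlt
    apply hI
    have hlt' : ‖(1 : reducedCStarAlgebra G) - a‖ < 1 := hlt
    have hu : IsUnit a := by
      have := (Units.oneSub _ hlt').isUnit
      rwa [Units.val_oneSub, sub_sub_cancel] at this
    obtain ⟨v, rfl⟩ := hu
    have h1 : (1 : reducedCStarAlgebra G) ∈ I := by
      have := I.mul_mem_left (v⁻¹ : (reducedCStarAlgebra G)ˣ).1 v.1 ha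
      rwa [Units.inv_mul] at this
    refine TwoSidedIdeal.ext fun x => ⟨fun _ => trivial, fun _ => ?_⟩
    have := I.mul_mem_left x 1 h1
    rwa [mul_one] at this
  let J : Submodule ℂ (ell2 G →L[ℂ] ell2 G) :=
    { carrier := {T | ∃ a ∈ I, a.1 = T}
      add_mem' := by
        rintro _ _ ⟨a, ha, rfl⟩ ⟨b, hb, rfl⟩
        exact ⟨a + b, I.add_mem ha hb, rfl⟩
      zero_mem' := ⟨0, I.zero_mem, rfl⟩
      smul_mem' := by
        rintro c _ ⟨a, ha, rfl⟩
        refine ⟨c • a, ?_, rfl⟩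
        have := I.mul_mem_left (c • 1) a ha
        rwa [smul_mul_assoc, one_mul] at this }
  have hone : ‖(1 : ell2 G →L[ℂ] ell2 G)‖ ≤ 1 := ContinuousLinearMap.norm_id_le
  -- The distance bound says that the class of `1` has quotient seminorm one; a norming functional
  -- of this class, pulled back, is the one sought.
  have hnorm : ‖(Submodule.Quotient.mk 1 : (ell2 G →L[ℂ] ell2 G) ⧸ J)‖ = 1 := by
    refine le_antisymm ((Submodule.Quotient.norm_mk_le J 1).trans hone) ?_
    refine QuotientAddGroup.le_norm_iff.2 fun m hm => ?_
    have hmem : (1 : ell2 G →L[ℂ] ell2 G) - m ∈ J := (Submodule.Quotient.eq J).1 hm.symm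
    obtain ⟨a, ha, ham⟩ := hmem
    have := hdist a ha
    rwa [ham, sub_sub_cancel] at this
  obtain ⟨g, hg, hg1⟩ := exists_dual_vector'' ℂ
    (Submodule.Quotient.mk 1 : (ell2 G →L[ℂ] ell2 G) ⧸ J)
  have hbound : ∀ T, ‖g (J.mkQ T)‖ ≤ 1 * ‖T‖ := fun T => by
    have h2 : ‖J.mkQ T‖ ≤ ‖T‖ := Submodule.Quotient.norm_mk_le J T
    exact (g.le_of_opNorm_le hg _).trans (mul_le_mul_of_nonneg_left h2 zero_le_one)
  refine ⟨LinearMap.mkContinuous (g.toLinearMap ∘ₗ J.mkQ) 1 hbound,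
    LinearMap.mkContinuous_norm_le _ zero_le_one _, ?_, fun a ha => ?_⟩
  · change g (Submodule.Quotient.mk 1) = 1
    rw [hg1, hnorm]
    simp
  · change g (Submodule.Quotient.mk a.1) = 0
    rw [(Submodule.Quotient.mk_eq_zero J).2 ⟨a, ha, rfl⟩, map_zero]

/-- The vector state `T ↦ ⟨δ_e, T δ_e⟩` at the unit of the group. -/
noncomputable def canonicalTrace : (ell2 G →L[ℂ] ell2 G) →L[ℂ] ℂ :=
  open Classical in
  (innerSL ℂ (lp.single 2 (1 : G) (1 : ℂ) : ell2 G)).comp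
    (ContinuousLinearMap.apply ℂ (ell2 G) (lp.single 2 (1 : G) (1 : ℂ) : ell2 G))

open Classical in
theorem canonicalTrace_apply (T : ell2 G →L[ℂ] ell2 G) :
    canonicalTrace T = inner ℂ (lp.single 2 (1 : G) (1 : ℂ) : ell2 G)
      (T (lp.single 2 (1 : G) (1 : ℂ))) := rfl

open Classical in
theorem leftRegular_single (s t : G) :
    leftRegular s (lp.single 2 t (1 : ℂ) : ell2 G) = lp.single 2 (s * t) (1 : ℂ) := by
  ext r
  rw [leftRegular_apply]
  by_cases h : r = s * t
  · subst h
    simp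
  · rw [lp.single_apply_ne _ _ _ h, lp.single_apply_ne]
    intro h'
    exact h (by rw [← h', mul_inv_cancel_left])

theorem canonicalTrace_leftRegular (s : G) (hs : s ≠ 1) : canonicalTrace (leftRegular s) = 0 := by
  classical
  rw [canonicalTrace_apply, leftRegular_single, mul_one, lp.inner_single_left,
    lp.single_apply_ne _ _ _ hs.symm, inner_zero_right]

theorem canonicalTrace_one : canonicalTrace (1 : ell2 G →L[ℂ] ell2 G) = 1 := by
  classical
  rw [canonicalTrace_apply, one_apply_eq_self, lp.inner_single_left,
    lp.single_apply_self]
  simp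

theorem canonicalTrace_star_mul_self (T : ell2 G →L[ℂ] ell2 G)
    (h : canonicalTrace (star T * T) = 0) :
    open Classical in T (lp.single 2 (1 : G) (1 : ℂ)) = 0 := by
  classical
  rw [canonicalTrace_apply] at h
  have h2 : inner ℂ (T (lp.single 2 (1 : G) (1 : ℂ)))
      (T (lp.single 2 (1 : G) (1 : ℂ))) = (0 : ℂ) := by
    rw [← h]
    exact (ContinuousLinearMap.adjoint_inner_right T _ _).symm
  exact inner_self_eq_zero.1 h2

/-- A functional that agrees with the canonical trace on the generators agrees with it on the
reduced C*-algebra. -/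
theorem eq_canonicalTrace {φ : (ell2 G →L[ℂ] ell2 G) →L[ℂ] ℂ} (h1 : φ 1 = 1)
    (h : ∀ s : G, s ≠ 1 → φ (leftRegular s) = 0) {T : ell2 G →L[ℂ] ell2 G}
    (hT : T ∈ reducedCStarAlgebra G) : φ T = canonicalTrace T := by
  have hspan : ∀ S ∈ StarAlgebra.adjoin ℂ (range (leftRegular (G := G))),
      S ∈ Submodule.span ℂ (range (leftRegular (G := G))) := by
    intro S hS
    induction hS using StarAlgebra.adjoin_induction with
    | mem x hx => exact Submodule.subset_span hx
    | algebraMap r =>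
      rw [Algebra.algebraMap_eq_smul_one, ← leftRegular_one]
      exact Submodule.smul_mem _ _ (Submodule.subset_span ⟨1, rfl⟩)
    | add x y _ _ hx hy => exact Submodule.add_mem _ hx hy
    | mul x y _ _ hx hy =>
      have := Submodule.mul_mem_mul hx hy
      rw [Submodule.span_mul_span] at this
      refine Submodule.span_mono ?_ this
      rintro _ ⟨_, ⟨s, rfl⟩, _, ⟨t, rfl⟩, rfl⟩
      exact ⟨s * t, (leftRegular_mul s t).symm⟩
    | star x hx₀ hx =>
      clear hx₀
      induction hx using Submodule.span_induction with
      | mem x hx =>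
        obtain ⟨s, rfl⟩ := hx
        exact Submodule.subset_span ⟨s⁻¹, (star_leftRegular s).symm⟩
      | zero => rw [star_zero]; exact Submodule.zero_mem _
      | add x y _ _ hx hy => rw [star_add]; exact Submodule.add_mem _ hx hy
      | smul c x _ hx => rw [star_smul]; exact Submodule.smul_mem _ _ hx
  have hgen : ∀ S ∈ Submodule.span ℂ (range (leftRegular (G := G))), φ S = canonicalTrace S := by
    intro S hS
    refine LinearMap.eqOn_span (f := φ.toLinearMap) (g := canonicalTrace.toLinearMap) ?_ hS
    rintro _ ⟨s, rfl⟩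
    change φ _ = canonicalTrace _
    rcases eq_or_ne s 1 with rfl | hs
    · rw [leftRegular_one, h1, canonicalTrace_one]
    · rw [h s hs, canonicalTrace_leftRegular s hs]
  have hclosed : IsClosed {S | φ S = canonicalTrace S} :=
    isClosed_eq φ.continuous canonicalTrace.continuous
  exact closure_minimal (fun S hS => hgen S (hspan S hS)) hclosed hT

variable {X : Type*} [TopologicalSpace X] [MulAction G X]

/-- The functional `f ↦ Re φ(M_f)`. -/
noncomputable def restrictFunctional (x₀ : X) (φ : WeakDual ℂ (ell2 G →L[ℂ] ell2 G)) :
    Functional X :=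
  StrongDual.toWeakDual
    ((Complex.reCLM.comp ((WeakDual.toStrongDual φ).restrictScalars ℝ)).comp (mulOpCLM x₀))

theorem restrictFunctional_apply (x₀ : X) (φ : WeakDual ℂ (ell2 G →L[ℂ] ell2 G)) (f : X →ᵇ ℝ) :
    restrictFunctional x₀ φ f = (φ (mulOp x₀ f)).re := rfl

theorem continuous_restrictFunctional (x₀ : X) :
    Continuous (restrictFunctional (G := G) x₀) :=
  WeakDual.continuous_of_continuous_eval fun f =>
    Complex.continuous_re.comp (WeakDual.eval_continuous (mulOp x₀ f))

/-- A unital contractive functional is positive: for `f ≥ 0` the function `‖f‖ - f` has norm at most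
`‖f‖`, so its value is at most `‖f‖`. -/
theorem restrictFunctional_mem (x₀ : X) {φ : WeakDual ℂ (ell2 G →L[ℂ] ell2 G)}
    (hφ : ‖WeakDual.toStrongDual φ‖ ≤ 1) (h1 : φ 1 = 1) :
    restrictFunctional x₀ φ ∈ stateSpace X := by
  have hone : restrictFunctional x₀ φ 1 = 1 := by
    rw [restrictFunctional_apply, mulOp_one, h1, Complex.one_re]
  refine ⟨hone, fun f hf => ?_⟩
  have hle : restrictFunctional x₀ φ (‖f‖ • 1 - f) ≤ ‖f‖ := by
    have h2 : ‖‖f‖ • (1 : X →ᵇ ℝ) - f‖ ≤ ‖f‖ := by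
      refine (BoundedContinuousFunction.norm_le (norm_nonneg f)).2 fun x => ?_
      have h3 := (le_abs_self _).trans (f.norm_coe_le_norm x)
      have h4 := hf x
      rw [Real.norm_eq_abs, abs_le]
      simp only [BoundedContinuousFunction.coe_sub, BoundedContinuousFunction.coe_smul,
        BoundedContinuousFunction.coe_one, Pi.sub_apply, Pi.one_apply, smul_eq_mul, mul_one]
      constructor <;> linarith [norm_nonneg f]
    rw [restrictFunctional_apply]
    refine (Complex.re_le_norm _).trans ?_
    have h5 := (WeakDual.toStrongDual φ).le_of_opNorm_le hφ (mulOp x₀ (‖f‖ • 1 - f))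
    rw [one_mul] at h5
    exact h5.trans ((norm_mulOp_le x₀ _).trans h2)
  rw [map_sub, map_smul, hone, smul_eq_mul, mul_one] at hle
  linarith

/-- The functional `T ↦ φ(λ_s⁻¹ T λ_s)`. -/
noncomputable def conjFunctional (φ : WeakDual ℂ (ell2 G →L[ℂ] ell2 G)) (s : G) :
    WeakDual ℂ (ell2 G →L[ℂ] ell2 G) :=
  StrongDual.toWeakDual ((WeakDual.toStrongDual φ).comp
    (((ContinuousLinearMap.mul ℂ (ell2 G →L[ℂ] ell2 G)).flip (leftRegular s)).comp
      (ContinuousLinearMap.mul ℂ (ell2 G →L[ℂ] ell2 G) (leftRegular s⁻¹))))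

theorem conjFunctional_apply (φ : WeakDual ℂ (ell2 G →L[ℂ] ell2 G)) (s : G)
    (T : ell2 G →L[ℂ] ell2 G) :
    conjFunctional φ s T = φ (leftRegular s⁻¹ * T * leftRegular s) := rfl

theorem norm_conjFunctional_le {φ : WeakDual ℂ (ell2 G →L[ℂ] ell2 G)}
    (hφ : ‖WeakDual.toStrongDual φ‖ ≤ 1) (s : G) :
    ‖WeakDual.toStrongDual (conjFunctional φ s)‖ ≤ 1 := by
  refine ContinuousLinearMap.opNorm_le_bound _ zero_le_one fun T => ?_
  refine ((WeakDual.toStrongDual φ).le_of_opNorm_le hφ _).trans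
    (mul_le_mul_of_nonneg_left ?_ zero_le_one)
  change ‖leftRegular s⁻¹ * T * leftRegular s‖ ≤ ‖T‖
  calc _ ≤ ‖leftRegular s⁻¹ * T‖ * ‖leftRegular s‖ := norm_mul_le _ _
    _ ≤ ‖leftRegular s⁻¹ * T‖ := mul_le_of_le_one_right (norm_nonneg _) (norm_leftRegular_le s)
    _ ≤ ‖leftRegular s⁻¹‖ * ‖T‖ := norm_mul_le _ _
    _ ≤ ‖T‖ := mul_le_of_le_one_left (norm_nonneg _) (norm_leftRegular_le s⁻¹)

variable [ContinuousConstSMul G X]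

theorem restrictFunctional_conjFunctional (x₀ : X) (φ : WeakDual ℂ (ell2 G →L[ℂ] ell2 G)) (s : G) :
    restrictFunctional x₀ (conjFunctional φ s) = act s (restrictFunctional x₀ φ) := by
  refine DFunLike.ext _ _ fun f => ?_
  rw [restrictFunctional_apply, conjFunctional_apply, leftRegular_inv_mul_mulOp_mul_leftRegular]
  rfl

/-- In a minimal state-proximal space, the closure of every orbit of states contains all point
evaluations. -/
theorem IsStateProximal.pointState_mem_closure [MulAction.IsMinimal G X]
    (hX : IsStateProximal G X) {ν : Functional X} (hν : ν ∈ stateSpace X) (y : X) :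
    pointState y ∈ closure (range fun s : G => act s ν) := by
  obtain ⟨x, hx⟩ := hX ν hν
  have hcl : IsClosed {z : X | pointState z ∈ closure (range fun s : G => act s ν)} :=
    isClosed_closure.preimage continuous_pointState
  rcases eq_empty_or_univ_of_smul_invariant_closed G hcl (by
    rintro s _ ⟨z, hz, rfl⟩
    exact act_mem_closure_range ν s hz) with h | h
  · exact (h.subset hx).elim
  · exact h.superset (mem_univ y)

/-- A functional of norm one whose restriction to `C(X)` is the evaluation at `y` vanishes at
`λ_s` whenever `s` moves `y`. -/
theorem apply_leftRegular_eq_zero [CompactSpace X] [T2Space X] (x₀ : X)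
    {φ : WeakDual ℂ (ell2 G →L[ℂ] ell2 G)} (hφ : ‖WeakDual.toStrongDual φ‖ ≤ 1) {y : X}
    (hy : restrictFunctional x₀ φ = pointState y) {s : G} (hs : s • y ≠ y) :
    φ (leftRegular s) = 0 := by
  have hval : ∀ a : X →ᵇ ℝ, (φ (mulOp x₀ a)).re = a y := fun a => DFunLike.congr_fun hy a
  have exists_bump : ∀ U ∈ 𝓝 y, ∃ a : X →ᵇ ℝ, (∀ x, |a x| ≤ 1) ∧ a y = 1 ∧ ∀ x ∉ U, a x = 0 := by
    intro U hU
    obtain ⟨f, hf0, hf1, hf⟩ := exists_continuous_zero_one_of_isClosed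
      (isOpen_interior (s := U)).isClosed_compl (isClosed_singleton (x := y))
      (by simpa [mem_interior_iff_mem_nhds] using hU)
    refine ⟨BoundedContinuousFunction.mkOfCompact f, fun x => ?_, hf1 rfl, fun x hx =>
      hf0 fun h => hx (interior_subset h)⟩
    change |f x| ≤ 1
    exact abs_le.2 ⟨by linarith [(hf x).1], (hf x).2⟩
  -- A bump `a` at `y`, supported where `b` vanishes, gives an operator `M_a` on which `φ` has real
  -- part one. Disjoint supports then feed the norm criterion.
  have left_zero : ∀ b : X →ᵇ ℝ, (∀ x, |b x| ≤ 1) → {x | b x = 0} ∈ 𝓝 y →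
      ∀ T : ell2 G →L[ℂ] ell2 G, φ (mulOp x₀ b * T) = 0 := by
    intro b hb hb0 T
    obtain ⟨a, ha, hay, haU⟩ := exists_bump _ hb0
    refine apply_eq_zero_of_norm_sq_add_smul_le (φ := WeakDual.toStrongDual φ) hφ
      (A := mulOp x₀ a) (N := ‖T‖) ((hval a).trans hay) fun z => ?_
    rw [← norm_smul, ← mul_smul_comm]
    exact norm_sq_mulOp_add_mulOp_mul_le x₀ ha hb (fun x => or_iff_not_imp_right.2 (haU x)) _
  have right_zero : ∀ b : X →ᵇ ℝ, (∀ x, |b x| ≤ 1) → {x | b x = 0} ∈ 𝓝 y →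
      ∀ T : ell2 G →L[ℂ] ell2 G, φ (T * mulOp x₀ b) = 0 := by
    intro b hb hb0 T
    obtain ⟨a, ha, hay, haU⟩ := exists_bump _ hb0
    refine apply_eq_zero_of_norm_sq_add_smul_le (φ := WeakDual.toStrongDual φ) hφ
      (A := mulOp x₀ a) (N := ‖T‖) ((hval a).trans hay) fun z => ?_
    rw [← norm_smul, ← smul_mul_assoc]
    exact norm_sq_mulOp_add_mul_mulOp_le x₀ ha hb (fun x => or_iff_not_imp_right.2 (haU x)) _
  -- Take `F` equal to one near `y` and zero near `s • y`. Then `λ_s = M_(1-F) λ_s + λ_s M_(F∘s)`,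
  -- and both `1 - F` and `F ∘ s` vanish near `y`.
  obtain ⟨U, hU, V, hV, hUc, hVc, hUV⟩ : ∃ U ∈ 𝓝 y, ∃ V ∈ 𝓝 (s • y), IsClosed U ∧ IsClosed V ∧
      Disjoint U V := by
    obtain ⟨U, hyU, hUo, V, hyV, hVo, hUV⟩ := exists_open_nhds_disjoint_closure hs.symm
    exact ⟨closure U, mem_of_superset (hUo.mem_nhds hyU) subset_closure, closure V,
      mem_of_superset (hVo.mem_nhds hyV) subset_closure, isClosed_closure, isClosed_closure, hUV⟩
  obtain ⟨f, hf0, hf1, hf⟩ := exists_continuous_zero_one_of_isClosed hVc hUc hUV.symm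
  let F : X →ᵇ ℝ := BoundedContinuousFunction.mkOfCompact f
  have hF : ∀ x, F x = f x := fun _ => rfl
  have h1 : φ (mulOp x₀ (1 - F) * leftRegular s) = 0 := by
    refine left_zero _ (fun x => ?_) (mem_of_superset hU fun x hx => ?_) _
    · have := hf x
      rw [abs_le]
      simp only [BoundedContinuousFunction.coe_sub, BoundedContinuousFunction.coe_one,
        Pi.sub_apply, Pi.one_apply, hF]
      exact ⟨by linarith [this.2], by linarith [this.1]⟩
    · have := hf1 hx
      simp only [mem_ofPred_eq, BoundedContinuousFunction.coe_sub,
        BoundedContinuousFunction.coe_one, Pi.sub_apply, Pi.one_apply, hF, this, sub_self]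
  have h2 : φ (mulOp x₀ F * leftRegular s) = 0 := by
    rw [mulOp_mul_leftRegular]
    refine right_zero _ (fun x => ?_)
      (mem_of_superset ((continuous_const_smul s).continuousAt hV) fun x hx => ?_) _
    · change |f (s • x)| ≤ 1
      exact abs_le.2 ⟨by linarith [(hf (s • x)).1], (hf (s • x)).2⟩
    · exact hf0 hx
  have h3 : mulOp (G := G) x₀ (1 - F) = 1 - mulOp x₀ F := by
    rw [← mulOp_one x₀]
    exact map_sub (mulOpCLM (G := G) x₀) 1 F
  rw [h3, sub_mul, one_mul, map_sub, h2, sub_zero] at h1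
  exact h1

/-- A group with a minimal strongly proximal action that has a free orbit is C*-simple. -/
theorem isCStarSimple_of_free_point [CompactSpace X] [T2Space X] [MulAction.IsMinimal G X]
    (hX : IsStateProximal G X) {y : X} (hy : ∀ s : G, s ≠ 1 → s • y ≠ y) : IsCStarSimple G := by
  intro I _
  rw [or_iff_not_imp_right]
  intro hI
  obtain ⟨ψ₀, hψn, hψ1, hψI⟩ := exists_functional_of_ne_top hI
  let ψ : WeakDual ℂ (ell2 G →L[ℂ] ell2 G) := StrongDual.toWeakDual ψ₀
  let B : Set (WeakDual ℂ (ell2 G →L[ℂ] ell2 G)) :=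
    {φ | ‖WeakDual.toStrongDual φ‖ ≤ 1} ∩ ({φ | φ 1 = 1} ∩ ⋂ a : I, {φ | φ a.1.1 = 0})
  have hball : {φ : WeakDual ℂ (ell2 G →L[ℂ] ell2 G) | ‖WeakDual.toStrongDual φ‖ ≤ 1} =
      WeakDual.toStrongDual ⁻¹'
        Metric.closedBall (0 : StrongDual ℂ (ell2 G →L[ℂ] ell2 G)) 1 := by
    ext φ
    exact (mem_closedBall_zero_iff (a := WeakDual.toStrongDual φ)).symm
  have hBc : IsCompact B := by
    refine IsCompact.inter_right (hball ▸ WeakDual.isCompact_closedBall 0 1) (IsClosed.inter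
      (isClosed_eq (WeakDual.eval_continuous 1) continuous_const)
      (isClosed_iInter fun a => isClosed_eq (WeakDual.eval_continuous a.1.1) continuous_const))
  have hconj : ∀ s : G, conjFunctional ψ s ∈ B := by
    intro s
    refine ⟨norm_conjFunctional_le hψn s, ?_, mem_iInter.2 fun a => ?_⟩
    · rw [mem_ofPred_eq, conjFunctional_apply, mul_one, leftRegular_mul, inv_mul_cancel,
        leftRegular_one]
      exact hψ1
    · exact hψI (⟨leftRegular s⁻¹, leftRegular_mem _⟩ * a.1 * ⟨leftRegular s, leftRegular_mem s⟩)
        (I.mul_mem_right _ _ (I.mul_mem_left _ _ a.2))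
  have hmem := hX.pointState_mem_closure (restrictFunctional_mem y (φ := ψ) hψn hψ1) y
  -- The set `B` is weak-* compact and contains all conjugates of `ψ`, so the limit point evaluation
  -- at `y` is the restriction of some functional in `B`.
  have himg : closure (range fun s : G => act s (restrictFunctional y ψ)) ⊆
      restrictFunctional y '' B :=
    closure_minimal (range_subset_iff.2 fun s =>
      ⟨_, hconj s, restrictFunctional_conjFunctional y ψ s⟩)
      (hBc.image (continuous_restrictFunctional y)).isClosed
  obtain ⟨φ, ⟨hφn, hφ1, hφI⟩, hφy⟩ := himg hmem
  have htrace : ∀ a ∈ I, canonicalTrace a.1 = 0 := fun a ha => by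
    rw [← eq_canonicalTrace (φ := WeakDual.toStrongDual φ) hφ1
      (fun s hs => apply_leftRegular_eq_zero y hφn hφy (hy s hs)) a.2]
    exact mem_iInter.1 hφI ⟨a, ha⟩
  have hzero : ∀ a ∈ I, a = 0 := by
    classical
    intro a ha
    refine Subtype.ext (eq_zero_of_apply_single fun t => ?_)
    -- Right translation moves the question to the unit: `b δ_e = a δ_t`, and the trace of `star b *
    -- b`, an element of the ideal, is `‖b δ_e‖²`.
    let b : reducedCStarAlgebra G := a * ⟨leftRegular t, leftRegular_mem t⟩
    have hb : b ∈ I := I.mul_mem_right _ _ ha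
    have hbb : canonicalTrace (star b.1 * b.1) = 0 :=
      htrace (star b * b) (I.mul_mem_left (star b) b hb)
    have h0 := canonicalTrace_star_mul_self b.1 hbb
    have h2 : b.1 (lp.single 2 (1 : G) (1 : ℂ)) = a.1 (lp.single 2 t (1 : ℂ)) := by
      change a.1 (leftRegular t (lp.single 2 (1 : G) (1 : ℂ))) = _
      rw [leftRegular_single, mul_one]
    rw [← h2]
    convert h0
  refine TwoSidedIdeal.ext fun a => ⟨fun ha => ?_, fun ha => ?_⟩
  · rw [hzero a ha]
    exact TwoSidedIdeal.zero_mem _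
  · rw [(TwoSidedIdeal.mem_bot _).1 ha]
    exact I.zero_mem

/-- A topologically free action of a countable group on a nonempty compact Hausdorff space has a
point with trivial stabilizer. -/
theorem exists_free_point {G X : Type u} [Group G] [TopologicalSpace X] [MulAction G X]
    [ContinuousConstSMul G X] [Countable G] [CompactSpace X] [T2Space X] [Nonempty X]
    (h : IsTopologicallyFree G X) : ∃ y : X, ∀ s : G, s ≠ 1 → s • y ≠ y := by
  have hd : Dense (⋂ s : {s : G // s ≠ 1}, {x : X | s.1 • x ≠ x}) :=
    dense_iInter_of_isOpen (fun s => isOpen_ne_fun (continuous_const_smul s.1) continuous_id)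
      fun s => h s.1 s.2
  obtain ⟨y, hy⟩ := hd.nonempty
  exact ⟨y, fun s hs => mem_iInter.1 hy ⟨s, hs⟩⟩

end Simple

end Tarski

theorem mainTheorem6 {G : Type u} [Group G] (p : ℕ)
    (hG : Tarski.IsTarskiMonster G p) (hna : ¬ Tarski.IsAmenable G) :
    (∃ (X : Type u) (_ : TopologicalSpace X) (_ : MulAction G X) (_ : ContinuousConstSMul G X),
      Tarski.IsFurstenbergBoundary G X) ∧
    (∀ (X : Type u) [TopologicalSpace X] [MulAction G X] [ContinuousConstSMul G X],
      Tarski.IsFurstenbergBoundary G X → Tarski.IsTopologicallyFree G X) ∧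
    Tarski.IsCStarSimple G := by
  have hfree : ∀ (X : Type u) [TopologicalSpace X] [MulAction G X] [ContinuousConstSMul G X],
      Tarski.IsFurstenbergBoundary G X → Tarski.IsTopologicallyFree G X := by
    intro X _ _ _ hX
    have := hX.isBoundary.compact
    have := hX.isBoundary.minimal
    exact hG.isTopologicallyFree fun x => hX.exists_smul_ne hna x
  refine ⟨Tarski.exists_isFurstenbergBoundary G, hfree, ?_⟩
  obtain ⟨X, _, _, _, hX⟩ := Tarski.exists_isFurstenbergBoundary G
  have := hX.isBoundary.compact
  have := hX.isBoundary.hausdorff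
  have := hX.isBoundary.nonempty
  have := hX.isBoundary.minimal
  -- Finite generation makes `G` countable, so Baire's theorem yields a point with trivial
  -- stabilizer.
  obtain ⟨S, hS, π, hπ⟩ := Group.fg_iff_exists_freeGroup_hom_surjective.1 hG.fg
  have := hS.countable.to_subtype
  have : Countable G := hπ.countable
  obtain ⟨y, hy⟩ := Tarski.exists_free_point (hfree X hX)
  exact Tarski.isCStarSimple_of_free_point
    (Tarski.isStronglyProximal_iff.1 hX.isBoundary.stronglyProximal) hy
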